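/- **Setting.** Let $E$ be a finite set and $E'\subset E$. For $x\in E$ let $P_x$ be a probability measure on a measurable space $\Omega$, and let $U:E\times\Omega\to[0,\infty]$ be measurable in $\omega$, with $0\le U(x,\omega)\le M<\infty$ for $x\in E'$ and $U(x,\omega)=+\infty$ for $x\in E\setminus E'$. Put $J(x)=\int U(x,\omega)\,P_x(d\omega)$, $J^\star=\min_E J$, $\chi_\epsilon=\{x\in E: J(x)\le J^\star+\epsilon\}$. Every $x\in E$ has a set $S_x\subset E$ of neighbours; the relation $y\in S_x$ is symmetric and connects $E$. Let $\mu_0$ be a probability measure on $E$ charging every point of $E'$, and $q_0$ a transition probability on $E$ that is irreducible ($\sum_{n\ge0}q_0^{(n)}(x,y)=\infty$ for all $x,y$) and $\mu_0$-reversible ($\mu_0(x)q_0(x,y)=\mu_0(y)q_0(y,x)$), with $q_0(x,S_x)=1$ and $q_0(x,y)>0$ for all $y\in S_x$, $y\ne x$. A path from $x$ to $y$ is a finite sequence $x_0=x,x_1,\dots,x_n=y$ with $x_{i+1}\in S_{x_i}$; let $H_{x,y}\in[0,\infty]$ be the minimum over such paths of $\max_i J(x_i)$, and $$m^\star=\max_{x,y}\{H_{x,y}-\max(J(x),J(y))\}\in[0,\infty],$$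 the maximum being over states of finite cost, i.e. $x,y\in E'$. Let $b,d>0$, $\alpha\in\mathbb R$, $\beta_t=b\log(1+td)$ and $n_t=(1+td)^\alpha$. For $x\neq y$ set $$\tilde q_t(x,y)=q_0(x,y)\,\mathbb E\Big[\exp\Big(-\tfrac{\beta_t}{N_t}\Big(\sum_{i=1}^{N_t}\big(U(y,\tilde\omega_i)-U(x,\omega_i)\big)\Big)_+\Big)\Big],\qquad \tilde q_t(x,x)=1-\sum_{z\ne x}\tilde q_t(x,z),$$ where the exponential is $0$ when the positive part is infinite, $N_t-1$ is Poisson with parameter $n_t$ and, independently of $N_t$, the pairs $(\omega_i,\tilde\omega_i)$ are i.i.d. with a given joint law on $\Omega\times\Omega$ (which may depend on $x,y$) whose marginals are $P_x$ and $P_y$ (for example independent draws, or $\tilde\omega_i=\omega_i$ if all $P_x$ are equal). Let $(\tilde\chi_k,T_k)_{k\ge0}$ be an $E\times\mathbb R_+$-valued Markov chain with $T_0=0$, $\tilde\chi_0\in E'$ almost surely (with any law on $E'$), and, for $y\in E$ and $u\ge0$, $$\Pr(\tilde\chi_{k+1}=y,\ T_{k+1}\ge u\mid \tilde\chi_k,T_k)=\int_u^\infty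 \tilde q_\tau(\tilde\chi_k,y)\,\mathbf 1_{\tau\ge T_k}\,e^{-(\tau-T_k)}\,d\tau .$$ The noisy simulated annealing process is $\tilde X_t=\tilde\chi_k$ for $T_k\le t<T_{k+1}$. **Theorem.** Assume $m^\star b<\min(\alpha/2,1)$. There is $\Gamma_2>0$ such that for every $\gamma\in(0,\alpha/2-m^\star b)$ there is $\Gamma_\gamma>0$ such that, for all $t$ large enough and all $\epsilon>0$ (the threshold on $t$ and the constants not depending on $\epsilon$): - if $\alpha\ge2$, then $\displaystyle\Pr(\tilde X_t\notin\chi_\epsilon)\le\Gamma_\gamma\Gamma_2(1+td)^{(m^\star b-1-b\epsilon)/2}+\Gamma_2(1+td)^{-b\epsilon}$; - if $\alpha<2$, then $\displaystyle\Pr(\tilde X_t\notin\chi_\epsilon)\le\Gamma_\gamma\Gamma_2(1+td)^{(m^\star b-\alpha/2+\gamma-b\epsilon)/2}+\Gamma_2(1+td)^{-b\epsilon}$. -/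

import Mathlib

open MeasureTheory Filter
open scoped ENNReal NNReal

/-- A noisy optimization problem on a finite search space `E`, with simulation conditions in `Ω`,
together with a neighbourhood structure and a proposition law. -/
structure NoisyProblem (E Ω : Type*) [Fintype E] [DecidableEq E] [MeasurableSpace Ω] where
  /-- the set `E'` of admissible states, on which the cost is finite -/
  admissible : Set E
  /-- `nbr x` is the set `S_x` of direct neighbours of `x` -/
  nbr : E → Set E
  nbr_symm : ∀ x y, y ∈ nbr x → x ∈ nbr y
  nbr_connected : ∀ x y, Relation.ReflTransGen (fun u v => v ∈ nbr u) x y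
  /-- the reference probability `μ₀` -/
  mu0 : E → ℝ
  mu0_nonneg : ∀ x, 0 ≤ mu0 x
  mu0_sum : ∑ x, mu0 x = 1
  mu0_pos : ∀ x ∈ admissible, 0 < mu0 x
  /-- the proposition law `q₀`, a transition probability on `E` -/
  q0 : Matrix E E ℝ
  q0_nonneg : ∀ x y, 0 ≤ q0 x y
  q0_sum : ∀ x, ∑ y, q0 x y = 1
  q0_irreducible : ∀ x y, ∑' n : ℕ, ENNReal.ofReal ((q0 ^ n) x y) = ⊤
  q0_reversible : ∀ x y, mu0 x * q0 x y = mu0 y * q0 y x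
  /-- `q₀(x, S_x) = 1` -/
  q0_nbr : ∀ x y, y ∉ nbr x → q0 x y = 0
  /-- every neighbour of `x` is proposed with positive probability -/
  q0_pos : ∀ x, ∀ y ∈ nbr x, y ≠ x → 0 < q0 x y
  /-- the noisy cost, with values in `[0, ∞]` -/
  U : E → Ω → ℝ≥0∞
  U_measurable : ∀ x, Measurable (U x)
  U_bounded : ∃ M : ℝ≥0, ∀ x ∈ admissible, ∀ ω, U x ω ≤ M
  U_infinite : ∀ x, x ∉ admissible → ∀ ω, U x ω = ⊤
  /-- the law of the simulation conditions used to evaluate the cost at `x` -/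
  noise : E → Measure Ω
  noise_prob : ∀ x, IsProbabilityMeasure (noise x)
  /-- The joint law of one pair of simulation conditions used to compare the current state `x` with
  the candidate `y`. It is `(noise x).prod (noise y)` for independent evaluations, and the image of
  a common law under `ω ↦ (ω, ω)` when both costs are evaluated at the same `ω`. -/
  pairNoise : E → E → Measure (Ω × Ω)
  pairNoise_fst : ∀ x y, (pairNoise x y).map Prod.fst = noise x
  pairNoise_snd : ∀ x y, (pairNoise x y).map Prod.snd = noise y

namespace NoisyProblem

variable {E Ω : Type*} [Fintype E] [DecidableEq E] [MeasurableSpace Ω]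

/-- The expected cost `J(x) = 𝔼 U(x, ω)`. -/
noncomputable def J (P : NoisyProblem E Ω) (x : E) : ℝ≥0∞ := ∫⁻ ω, P.U x ω ∂(P.noise x)

/-- The set `χ_ε` of `ε`-optimal states. -/
def nearOptimal (P : NoisyProblem E Ω) (ε : ℝ) : Set E :=
  {x | P.J x ≤ (⨅ y, P.J y) + ENNReal.ofReal ε}

/-- `p 0, …, p n` is a path from `x` to `y` for the neighbourhood structure. -/
def IsPath (P : NoisyProblem E Ω) (x y : E) (n : ℕ) (p : Fin (n + 1) → E) : Prop :=
  p 0 = x ∧ p (Fin.last n) = y ∧ ∀ i : Fin n, p i.succ ∈ P.nbr (p i.castSucc)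

/-- The elevation `H_{x,y}` of the cheapest path from `x` to `y`. -/
noncomputable def elevation (P : NoisyProblem E Ω) (x y : E) : ℝ≥0∞ :=
  ⨅ (n : ℕ) (p : Fin (n + 1) → E) (_ : P.IsPath x y n p), ⨆ i, P.J (p i)

/-- `m⋆ = max_{x,y} (H_{x,y} - max (J x) (J y))`. Pairs with a state of infinite cost contribute
`∞ - ∞ = 0`, so that this is the maximum over pairs of admissible states. -/
noncomputable def mStar (P : NoisyProblem E Ω) : ℝ≥0∞ :=
  ⨆ (x : E) (y : E), (P.elevation x y - max (P.J x) (P.J y))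

/-- `exp (-β r)`, with `exp (-∞) = 0` (also at `β = 0`). -/
noncomputable def expNeg (β : ℝ) (r : ℝ≥0∞) : ℝ :=
  if r = ⊤ then 0 else Real.exp (-(β * r.toReal))

/-- The expected acceptance probability of a move from `x` to `y` at inverse temperature `β`, the
costs being estimated with `N ∼ Poisson(ν) + 1` samples. Subtraction in `[0, ∞]` is truncated, hence
gives the positive part. -/
noncomputable def acceptProb (P : NoisyProblem E Ω) (β : ℝ) (ν : ℝ≥0) (x y : E) : ℝ :=
  ∫ k : ℕ, (∫ ω : Fin (k + 1) → Ω × Ω,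
      expNeg β (((∑ i, P.U y (ω i).2) - ∑ i, P.U x (ω i).1) / ((k + 1 : ℕ) : ℝ≥0∞))
      ∂(Measure.pi fun _ => P.pairNoise x y)) ∂(ProbabilityTheory.poissonMeasure ν)

/-- The noisy transition probabilities at inverse temperature `β` and sampling intensity `ν`. -/
noncomputable def qNoisy (P : NoisyProblem E Ω) (β : ℝ) (ν : ℝ≥0) (x y : E) : ℝ :=
  if y = x then 1 - ∑ z ∈ Finset.univ.erase x, P.q0 x z * P.acceptProb β ν x z
  else P.q0 x y * P.acceptProb β ν x y

/-- The noisy transition probabilities at time `t`, for `β_t = b log (t d + 1)` and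
`n_t = (1 + t d) ^ α`. -/
noncomputable def qTime (P : NoisyProblem E Ω) (b d α t : ℝ) (x y : E) : ℝ :=
  P.qNoisy (b * Real.log (t * d + 1)) ((1 + t * d) ^ α).toNNReal x y

/-- `X` is a noisy simulated annealing process on the probability space `(Ξ, ℙ)`, with embedded
chain of states `χ` and jump times `T`, started from an admissible state. -/
structure IsNSARun (P : NoisyProblem E Ω) (b d α : ℝ) [MeasurableSpace E]
    {Ξ : Type*} [MeasurableSpace Ξ] (ℙ : Measure Ξ)
    (χ : ℕ → Ξ → E) (T : ℕ → Ξ → ℝ) (X : ℝ → Ξ → E) : Prop where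
  measurable_state : ∀ k, Measurable (χ k)
  measurable_time : ∀ k, Measurable (T k)
  time_zero : ∀ᵐ ξ ∂ℙ, T 0 ξ = 0
  init_admissible : ∀ᵐ ξ ∂ℙ, χ 0 ξ ∈ P.admissible
  /-- `(χ_k, T_k)` is a Markov chain: given the past up to step `k`, the event
  `{χ_{k+1} = y, T_{k+1} ≥ u}` has probability
  `∫_u^∞ q̃_τ(χ_k, y) 1_{τ ≥ T_k} exp(-(τ - T_k)) dτ`. -/
  transition : ∀ (k : ℕ) (y : E) (u : ℝ), 0 ≤ u →
    ℙ[({ξ | χ (k + 1) ξ = y ∧ u ≤ T (k + 1) ξ}.indicator fun _ => (1 : ℝ)) |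
        ⨆ i ∈ Set.Iic k, MeasurableSpace.comap (fun ξ => (χ i ξ, T i ξ)) inferInstance]
      =ᵐ[ℙ] fun ξ => ∫ τ in Set.Ici u, (Set.Ici (T k ξ)).indicator
        (fun τ => P.qTime b d α τ (χ k ξ) y * Real.exp (-(τ - T k ξ))) τ
  /-- `X_t = χ_k` for `T_k ≤ t < T_{k+1}` -/
  jump : ∀ᵐ ξ ∂ℙ, ∀ (k : ℕ) (t : ℝ), T k ξ ≤ t → t < T (k + 1) ξ → X t ξ = χ k ξ

end NoisyProblem

/-! ### Sampling error of the acceptance probability -/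

section Sampling

variable {S : Type*} [MeasurableSpace S]

/-! Put `s = 1 + t d`, so that `exp (-β_t (J - J⋆)) = s ^ (-θ)` with `θ = b (J - J⋆)`. The noisy
dynamics on `E'` is compared with the Metropolis dynamics at the same temperature, which is
reversible for the Gibbs weights `w = μ₀ s ^ (-θ)` of total mass `Z`. The quantity followed in time
is the chi-square excess `G = ∑ w (m / w - 1 / Z)²` of the law `m` of the process over the moving
Gibbs measure.

Three effects act on `G`. Any two states of `E'` are joined by a path rising at most `a = m⋆ b` (in
exponents) above the higher one, so a Poincaré inequality with constant `O(s ^ a)` holds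
(`exists_poincare`) and damps `G` at rate `s ^ (-a)`. Cooling moves the weights at relative speed
`O(1 / s)` (`hasDerivAt_energy_sub`). Noise changes the rates by a relative error `δ = O(s ^
(-α/4))`, by Hoeffding's lemma and a Chernoff bound for the Poisson sample size
(`exists_abs_acceptProb_sub_le`). Since the error is relative, Young's inequality absorbs it into
half of the dissipation and leaves only `δ² = O(s ^ (-α/2))` times the energy (`sum_master_le`).

With `κ = min (α/2) 1` this reads `G' ≤ -c s ^ (-a) G + A s ^ (-κ) (G + B₀)`, and `a < κ ≤ 1` gives
`G = O(s ^ (a - κ))` (`exists_le_rpow_of_deriv_le`). The Gibbs mass of the states that are not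
`ε`-optimal is `O(s ^ (-bε))`; by Cauchy–Schwarz the deviation from it is at most `√G s ^ (-bε/2)`
(`sum_filter_le`). These are the two terms of the bound; the loss `γ` is not needed for it.

The differential equation for `m` comes from the embedded chain: the probabilities of occupying a
state during the `k`-th sojourn, summed over `k`, satisfy a Duhamel formula, which yields the
forward equation (`hasDerivAt_toReal_mass`) and excludes explosion (`sum_toReal_mass`). -/

/-- Hoeffding's lemma for a sum of i.i.d. bounded variables. -/
theorem integrable_exp_centered_sum {μ : Measure S} [IsProbabilityMeasure μ] {Y : S → ℝ}
    (hY : Measurable Y) {M : ℝ} (hM : ∀ ω, |Y ω| ≤ M) (n : ℕ) (l : ℝ) :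
    Integrable (fun ω : Fin n → S => Real.exp (l * ∑ i, (Y (ω i) - ∫ z, Y z ∂μ)))
        (Measure.pi fun _ => μ) ∧
      ∫ ω : Fin n → S, Real.exp (l * ∑ i, (Y (ω i) - ∫ z, Y z ∂μ)) ∂(Measure.pi fun _ => μ)
        ≤ Real.exp (n * M ^ 2 * l ^ 2 / 2) := by
  have hsub : ProbabilityTheory.HasSubgaussianMGF (fun ω => Y ω - ∫ z, Y z ∂μ)
      ((‖M - (-M)‖₊ / 2) ^ 2) μ :=
    ProbabilityTheory.hasSubgaussianMGF_of_mem_Icc hY.aemeasurable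
      (ae_of_all _ fun ω => ⟨(abs_le.1 (hM ω)).1, (abs_le.1 (hM ω)).2⟩)
  have hind : ProbabilityTheory.iIndepFun
      (fun (i : Fin n) (ω : Fin n → S) => Y (ω i) - ∫ z, Y z ∂μ) (Measure.pi fun _ => μ) :=
    ProbabilityTheory.iIndepFun_pi (X := fun (_ : Fin n) ω => Y ω - ∫ z, Y z ∂μ)
      (fun _ => (hY.sub_const _).aemeasurable)
  have hi : ∀ i ∈ (Finset.univ : Finset (Fin n)), ProbabilityTheory.HasSubgaussianMGF
      (fun ω : Fin n → S => Y (ω i) - ∫ z, Y z ∂μ) ((‖M - (-M)‖₊ / 2) ^ 2)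
      (Measure.pi fun _ => μ) := by
    intro i _
    have hmp := measurePreserving_eval (fun _ : Fin n => μ) i
    refine ProbabilityTheory.HasSubgaussianMGF.of_map (Y := Function.eval i)
      (X := fun ω => Y ω - ∫ z, Y z ∂μ) hmp.measurable.aemeasurable ?_
    rwa [hmp.map_eq]
  have hsum := ProbabilityTheory.HasSubgaussianMGF.sum_of_iIndepFun hind hi
  refine ⟨hsum.integrable_exp_mul l, (hsum.mgf_le l).trans (le_of_eq ?_)⟩
  congr 1
  simp only [Finset.sum_const, Finset.card_univ, Fintype.card_fin, nsmul_eq_mul]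
  push_cast
  rw [Real.norm_eq_abs]
  have : (|M - -M| / 2) ^ 2 = M ^ 2 := by
    rw [div_pow, sq_abs]; ring
  rw [this]

/-- The sampled acceptance probability `exp (-β (N⁻¹ ∑ Y)₊)` for `N = n + 1` samples. -/
noncomputable def sampledAccept (μ : Measure S) (Y : S → ℝ) (β : ℝ) (n : ℕ) : ℝ :=
  ∫ ω : Fin (n + 1) → S, Real.exp (-(β * (max 0 (∑ i, Y (ω i)) / (n + 1 : ℝ))))
    ∂(Measure.pi fun _ => μ)

theorem integrable_sampledAccept {μ : Measure S} [IsProbabilityMeasure μ] {Y : S → ℝ}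
    (hY : Measurable Y) {β : ℝ} (hβ : 0 ≤ β) (n : ℕ) :
    Integrable (fun ω : Fin (n + 1) → S =>
      Real.exp (-(β * (max 0 (∑ i, Y (ω i)) / (n + 1 : ℝ))))) (Measure.pi fun _ => μ) := by
  refine Integrable.of_bound (C := 1) ?_ (ae_of_all _ fun ω => ?_)
  · exact Measurable.aestronglyMeasurable (by fun_prop)
  · rw [Real.norm_eq_abs, abs_of_nonneg (Real.exp_nonneg _), Real.exp_le_one_iff]
    have : 0 ≤ max 0 (∑ i, Y (ω i)) / (n + 1 : ℝ) := by positivity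
    nlinarith

theorem sampledAccept_le_one {μ : Measure S} [IsProbabilityMeasure μ] {Y : S → ℝ}
    (hY : Measurable Y) {β : ℝ} (hβ : 0 ≤ β) (n : ℕ) : sampledAccept μ Y β n ≤ 1 := by
  have h := integral_mono (integrable_sampledAccept (μ := μ) hY hβ n) (integrable_const (1 : ℝ))
    (fun ω => by
      rw [Real.exp_le_one_iff]
      have : 0 ≤ max 0 (∑ i, Y (ω i)) / (n + 1 : ℝ) := by positivity
      nlinarith)
  simpa [sampledAccept] using h

/-- Dropping the positive part can only increase the exponential, and what remains is the
exponential moment of the centred sum at `l = -β / (n + 1)`. The bound serves when the mean of `Y`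
is nonnegative; otherwise the trivial bound `1` is already the target. -/
theorem sampledAccept_le {μ : Measure S} [IsProbabilityMeasure μ] {Y : S → ℝ}
    (hY : Measurable Y) {M : ℝ} (hM : ∀ ω, |Y ω| ≤ M) {β : ℝ} (hβ : 0 ≤ β) (n : ℕ) :
    sampledAccept μ Y β n ≤
      Real.exp (-(β * ∫ z, Y z ∂μ)) * Real.exp (M ^ 2 * β ^ 2 / (2 * (n + 1))) := by
  obtain ⟨h1, h2⟩ := integrable_exp_centered_sum (μ := μ) hY hM (n + 1) (-β / (n + 1))
  have hn : (0 : ℝ) < n + 1 := by positivity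
  have h := integral_mono (integrable_sampledAccept (μ := μ) hY hβ n)
    (h1.const_mul (Real.exp (-(β * ∫ z, Y z ∂μ)))) (fun ω => by
      simp only
      rw [← Real.exp_add]
      refine Real.exp_le_exp.2 ?_
      rw [Finset.sum_sub_distrib]
      simp only [Finset.sum_const, Finset.card_univ, Fintype.card_fin, nsmul_eq_mul]
      push_cast
      have e : -(β * ∫ z, Y z ∂μ) + -β / (n + 1) * (∑ i, Y (ω i) - (n + 1) * ∫ z, Y z ∂μ)
        = -(β * ((∑ i, Y (ω i)) / (n + 1))) := by field_simp; ring
      rw [e]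
      gcongr
      exact le_max_right _ _)
  rw [integral_const_mul] at h
  refine h.trans (mul_le_mul_of_nonneg_left (h2.trans (le_of_eq ?_)) (Real.exp_nonneg _))
  congr 1
  push_cast
  field_simp

/-- By `exp (-x) ≥ 1 - x`, the relative loss is at most `β` times the mean deviation of the sample
average, which is of order `1 / √(n + 1)`. The deviation is bounded through `|u| ≤ exp u + exp (-u)`
applied to the centred sum divided by `√(n + 1)`, a scale at which both exponential moments are at
most `exp (M ^ 2 / 2)`. -/
theorem le_sampledAccept {μ : Measure S} [IsProbabilityMeasure μ] {Y : S → ℝ}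
    (hY : Measurable Y) {M : ℝ} (hM : ∀ ω, |Y ω| ≤ M) {β : ℝ} (hβ : 0 ≤ β) (n : ℕ) :
    Real.exp (-(β * max 0 (∫ z, Y z ∂μ))) *
      (1 - 2 * Real.exp (M ^ 2 / 2) * β / Real.sqrt (n + 1)) ≤ sampledAccept μ Y β n := by
  have hn : (0 : ℝ) < n + 1 := by positivity
  set r := Real.sqrt (n + 1) with hr
  have hr0 : 0 < r := Real.sqrt_pos.2 hn
  have hrr : r * r = n + 1 := Real.mul_self_sqrt hn.le
  obtain ⟨h1, h2⟩ := integrable_exp_centered_sum (μ := μ) hY hM (n + 1) (1 / r)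
  obtain ⟨h3, h4⟩ := integrable_exp_centered_sum (μ := μ) hY hM (n + 1) (-(1 / r))
  set D := ∫ z, Y z ∂μ with hD
  set W : (Fin (n + 1) → S) → ℝ := fun ω => ∑ i, (Y (ω i) - D) with hW
  have hsq : ((n + 1 : ℕ) : ℝ) * M ^ 2 * (1 / r) ^ 2 / 2 = M ^ 2 / 2 := by
    push_cast; rw [← hrr]; field_simp
  have hsq' : ((n + 1 : ℕ) : ℝ) * M ^ 2 * (-(1 / r)) ^ 2 / 2 = M ^ 2 / 2 := by
    rw [neg_sq]; exact hsq
  rw [hsq] at h2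
  rw [hsq'] at h4
  have hint : Integrable (fun ω => Real.exp (-(β * max 0 D)) * (1 - β / r *
      (Real.exp (1 / r * W ω) + Real.exp (-(1 / r) * W ω)))) (Measure.pi fun _ => μ) :=
    ((integrable_const (1 : ℝ)).sub ((h1.add h3).const_mul _)).const_mul _
  have h := integral_mono hint (integrable_sampledAccept (μ := μ) hY hβ n) (fun ω => by
    simp only
    have hsum : ∑ i, Y (ω i) = W ω + (n + 1) * D := by
      simp only [hW, Finset.sum_sub_distrib, Finset.sum_const, Finset.card_univ, Fintype.card_fin,
        nsmul_eq_mul]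
      push_cast; ring
    set v := max 0 (∑ i, Y (ω i)) / (n + 1 : ℝ) with hv
    have hvD : v ≤ max 0 D + |W ω| / (n + 1) := by
      rw [hv, div_le_iff₀ hn, add_mul, div_mul_cancel₀ _ hn.ne', hsum]
      refine max_le (by positivity) ?_
      have := le_max_right 0 D
      have := le_abs_self (W ω)
      nlinarith
    have habs : |W ω| / (n + 1) ≤ 1 / r *
        (Real.exp (1 / r * W ω) + Real.exp (-(1 / r) * W ω)) := by
      have e1 : |W ω| / (n + 1) = 1 / r * |1 / r * W ω| := by
        rw [abs_mul, abs_of_pos (by positivity : 0 < 1 / r), ← hrr]; field_simp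
      rw [e1]
      refine mul_le_mul_of_nonneg_left ?_ (by positivity)
      rw [neg_mul]
      generalize 1 / r * W ω = u
      rcases abs_cases u with ⟨hu, _⟩ | ⟨hu, _⟩ <;> rw [hu]
      · linarith [Real.add_one_le_exp u, Real.exp_pos (-u)]
      · linarith [Real.add_one_le_exp (-u), Real.exp_pos u]
    have hexp : Real.exp (-(β * v)) = Real.exp (-(β * max 0 D)) *
        Real.exp (-(β * (v - max 0 D))) := by
      rw [← Real.exp_add]; congr 1; ring
    rw [hexp]
    refine mul_le_mul_of_nonneg_left ?_ (Real.exp_nonneg _)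
    have ht := Real.add_one_le_exp (-(β * (v - max 0 D)))
    have : β * (v - max 0 D) ≤
        β * (1 / r * (Real.exp (1 / r * W ω) + Real.exp (-(1 / r) * W ω))) :=
      mul_le_mul_of_nonneg_left (by linarith) hβ
    have e2 : β / r * (Real.exp (1 / r * W ω) + Real.exp (-(1 / r) * W ω)) =
      β * (1 / r * (Real.exp (1 / r * W ω) + Real.exp (-(1 / r) * W ω))) := by ring
    linarith)
  refine le_trans ?_ h
  have hadd : Integrable (fun ω => β / r *
      (Real.exp (1 / r * W ω) + Real.exp (-(1 / r) * W ω))) (Measure.pi fun _ => μ) :=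
    (h1.add h3).const_mul _
  rw [integral_const_mul, integral_sub (integrable_const _) hadd,
    integral_const_mul, integral_add h1 h3]
  refine mul_le_mul_of_nonneg_left ?_ (Real.exp_nonneg _)
  simp only [integral_const, probReal_univ, smul_eq_mul, mul_one]
  have : β / r * ((∫ ω, Real.exp (1 / r * W ω) ∂(Measure.pi fun _ => μ)) +
      ∫ ω, Real.exp (-(1 / r) * W ω) ∂(Measure.pi fun _ => μ)) ≤
      β / r * (Real.exp (M ^ 2 / 2) + Real.exp (M ^ 2 / 2)) :=
    mul_le_mul_of_nonneg_left (add_le_add h2 h4) (by positivity)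
  have e3 : β / r * (Real.exp (M ^ 2 / 2) + Real.exp (M ^ 2 / 2)) =
    2 * Real.exp (M ^ 2 / 2) * β / r := by ring
  linarith

theorem sampledAccept_nonneg (μ : Measure S) (Y : S → ℝ) (β : ℝ) (n : ℕ) :
    0 ≤ sampledAccept μ Y β n := integral_nonneg fun _ => (Real.exp_nonneg _)

theorem integrable_poisson_of_mem_Icc {a : ℕ → ℝ} (h0 : ∀ n, 0 ≤ a n) (h1 : ∀ n, a n ≤ 1)
    (ν : ℝ≥0) : Integrable a (ProbabilityTheory.poissonMeasure ν) :=
  Integrable.of_bound (C := 1) Measurable.of_discrete.aestronglyMeasurable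
    (ae_of_all _ fun n => by rw [Real.norm_eq_abs, abs_of_nonneg (h0 n)]; exact h1 n)

/-- The generating function of the Poisson law at `1/2`, used in the Chernoff bound for the event
that few samples are drawn. -/
theorem integral_two_inv_pow_poisson (ν : ℝ≥0) :
    ∫ k : ℕ, (2⁻¹ : ℝ) ^ k ∂(ProbabilityTheory.poissonMeasure ν) = Real.exp (-(ν / 2)) := by
  rw [ProbabilityTheory.integral_poissonMeasure]
  have h : HasSum (fun n : ℕ => Real.exp (-ν) * (((ν : ℝ) / 2) ^ n / n.factorial))
      (Real.exp (-ν) * Real.exp (ν / 2)) := by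
    refine HasSum.mul_left _ ?_
    rw [Real.exp_eq_exp_ℝ]
    exact NormedSpace.expSeries_div_hasSum_exp ((ν : ℝ) / 2)
  rw [← Real.exp_add] at h
  rw [show -((ν : ℝ) / 2) = -ν + ν / 2 by ring, ← h.tsum_eq]
  congr 1
  ext n
  rw [smul_eq_mul, div_pow]
  simp only [inv_pow]
  field_simp

/-- The lower tail of a Poisson variable, as a bound on the indicator of `k + 1 < ν / 2`. -/
theorem one_le_two_rpow_mul {ν : ℝ} {k : ℕ} (h : (k : ℝ) + 1 < ν / 2) :
    1 ≤ (2 : ℝ) ^ (ν / 2) * 2⁻¹ ^ k := by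
  rw [inv_pow, ← Real.rpow_natCast, ← Real.rpow_neg (by norm_num), ← Real.rpow_add (by norm_num)]
  exact Real.one_le_rpow (by norm_num) (by linarith)

/-- `2 ^ (ν/2) exp (-ν/2) ≤ exp (-ν/8)`. -/
theorem two_rpow_mul_exp_le {ν : ℝ} (hν : 0 ≤ ν) :
    (2 : ℝ) ^ (ν / 2) * Real.exp (-(ν / 2)) ≤ Real.exp (-(ν / 8)) := by
  rw [Real.rpow_def_of_pos (by norm_num), ← Real.exp_add]
  refine Real.exp_le_exp.2 ?_
  -- The exponent `(ν / 2) (log 2 - 1)` is at most `-ν / 8` as soon as `log 2 ≤ 3/4`.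
  have := Real.log_two_lt_d9
  nlinarith

/-- The relative error of the mean acceptance probability with `Poisson(ν) + 1` samples. -/
theorem abs_integral_sampledAccept_sub_le {μ : Measure S} [IsProbabilityMeasure μ] {Y : S → ℝ}
    (hY : Measurable Y) {M : ℝ} (hM : ∀ ω, |Y ω| ≤ M) {β : ℝ} (hβ : 0 ≤ β) {ν : ℝ≥0}
    (hν : 0 < ν) :
    |∫ k, sampledAccept μ Y β k ∂(ProbabilityTheory.poissonMeasure ν) -
        Real.exp (-(β * max 0 (∫ z, Y z ∂μ)))| ≤
      ((Real.exp (M ^ 2 * β ^ 2 / ν) - 1 + Real.exp (β * M) * Real.exp (-(ν / 8))) +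
        2 * Real.exp (M ^ 2 / 2) * β * (2 / Real.sqrt ν + Real.exp (-(ν / 8)))) *
      Real.exp (-(β * max 0 (∫ z, Y z ∂μ))) := by
  set D := ∫ z, Y z ∂μ with hD
  have hν' : (0 : ℝ) < ν := by exact_mod_cast hν
  have hM0 : 0 ≤ M := (abs_nonneg _).trans (hM (Classical.choice
    (by by_contra hne; rw [not_nonempty_iff] at hne; exact IsProbabilityMeasure.ne_zero μ
          (Measure.eq_zero_of_isEmpty μ))))
  have hDM : max 0 D ≤ M := by
    refine max_le hM0 ?_
    have h := norm_integral_le_of_norm_le_const (μ := μ) (f := Y) (C := M)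
      (ae_of_all _ fun ω => hM ω)
    rw [probReal_univ, mul_one] at h
    exact (le_abs_self _).trans h
  have htail : ∫ k : ℕ, (2 : ℝ) ^ ((ν : ℝ) / 2) * 2⁻¹ ^ k ∂(ProbabilityTheory.poissonMeasure ν)
      ≤ Real.exp (-(ν / 8)) := by
    rw [integral_const_mul, integral_two_inv_pow_poisson]
    exact two_rpow_mul_exp_le hν'.le
  have hti : Integrable (fun k : ℕ => (2 : ℝ) ^ ((ν : ℝ) / 2) * 2⁻¹ ^ k)
      (ProbabilityTheory.poissonMeasure ν) :=
    (integrable_poisson_of_mem_Icc (fun n => by positivity)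
      (fun n => pow_le_one₀ (by norm_num) (by norm_num)) ν).const_mul _
  have hAi : Integrable (sampledAccept μ Y β) (ProbabilityTheory.poissonMeasure ν) :=
    integrable_poisson_of_mem_Icc (sampledAccept_nonneg μ Y β) (sampledAccept_le_one hY hβ) ν
  set e0 := Real.exp (-(β * max 0 D)) with he0
  have he0pos : 0 < e0 := Real.exp_pos _
  -- The Metropolis factor is never below `exp (-β M)`; at this price the additive Poisson tail
  -- becomes a relative error.
  have heM : 1 ≤ Real.exp (β * M) * e0 := by
    rw [he0, ← Real.exp_add]
    exact Real.one_le_exp (by nlinarith)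
  have hup : ∫ k, sampledAccept μ Y β k ∂(ProbabilityTheory.poissonMeasure ν) ≤
      e0 * Real.exp (M ^ 2 * β ^ 2 / ν) + Real.exp (-(ν / 8)) := by
    have h := integral_mono hAi ((integrable_const (e0 * Real.exp (M ^ 2 * β ^ 2 / ν))).add hti)
      (fun k => by
        simp only [Pi.add_apply]
        have hpos : (0 : ℝ) ≤ (2 : ℝ) ^ ((ν : ℝ) / 2) * 2⁻¹ ^ k := by positivity
        rcases lt_or_ge ((k : ℝ) + 1) (ν / 2) with hk | hk
        · have := one_le_two_rpow_mul hk
          have := sampledAccept_le_one (μ := μ) hY hβ k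
          have : 0 ≤ e0 * Real.exp (M ^ 2 * β ^ 2 / ν) := by positivity
          linarith
        · have hexp : Real.exp (M ^ 2 * β ^ 2 / (2 * (k + 1))) ≤
              Real.exp (M ^ 2 * β ^ 2 / ν) := by
            refine Real.exp_le_exp.2 ?_
            gcongr
            linarith
          have : sampledAccept μ Y β k ≤ e0 * Real.exp (M ^ 2 * β ^ 2 / ν) := by
            rcases le_total D 0 with hD0 | hD0
            · have : e0 = 1 := by rw [he0, max_eq_left hD0]; simp
              rw [this, one_mul]
              exact (sampledAccept_le_one hY hβ k).trans (Real.one_le_exp (by positivity))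
            · refine (sampledAccept_le hY hM hβ k).trans ?_
              rw [he0, max_eq_right hD0]
              exact mul_le_mul_of_nonneg_left hexp (Real.exp_nonneg _)
          linarith)
    refine h.trans ?_
    simp only [Pi.add_apply]
    rw [integral_add (integrable_const _) hti]
    simp only [integral_const, probReal_univ, smul_eq_mul, one_mul]
    linarith
  set c := 2 * Real.exp (M ^ 2 / 2) * β with hc
  have hc0 : 0 ≤ c := by positivity
  have hlow : e0 * (1 - c * (2 / Real.sqrt ν + Real.exp (-(ν / 8)))) ≤
      ∫ k, sampledAccept μ Y β k ∂(ProbabilityTheory.poissonMeasure ν) := by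
    have hadd : Integrable (fun k : ℕ => c * (2 / Real.sqrt ν + (2 : ℝ) ^ ((ν : ℝ) / 2) * 2⁻¹ ^ k))
        (ProbabilityTheory.poissonMeasure ν) :=
      ((integrable_const (2 / Real.sqrt ν)).add hti).const_mul c
    have hall : Integrable (fun k : ℕ => e0 *
        (1 - c * (2 / Real.sqrt ν + (2 : ℝ) ^ ((ν : ℝ) / 2) * 2⁻¹ ^ k)))
        (ProbabilityTheory.poissonMeasure ν) := ((integrable_const (1 : ℝ)).sub hadd).const_mul e0
    have h := integral_mono hall hAi
      (fun k => by
        refine le_trans (mul_le_mul_of_nonneg_left ?_ he0pos.le) (le_sampledAccept hY hM hβ k)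
        have hpos : (0 : ℝ) ≤ (2 : ℝ) ^ ((ν : ℝ) / 2) * 2⁻¹ ^ k := by positivity
        have hsν : 0 < Real.sqrt ν := Real.sqrt_pos.2 hν'
        have hs1 : 1 ≤ Real.sqrt (k + 1) := Real.one_le_sqrt.2 (by linarith [k.cast_nonneg (α := ℝ)])
        have key : 1 / Real.sqrt (k + 1) ≤ 2 / Real.sqrt ν + (2 : ℝ) ^ ((ν : ℝ) / 2) * 2⁻¹ ^ k := by
          rcases lt_or_ge ((k : ℝ) + 1) (ν / 2) with hk | hk
          · have := one_le_two_rpow_mul hk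
            have : 1 / Real.sqrt (k + 1) ≤ 1 := by rw [div_le_one (by linarith)]; exact hs1
            have : 0 ≤ 2 / Real.sqrt ν := by positivity
            linarith
          · have : 1 / Real.sqrt (k + 1) ≤ 2 / Real.sqrt ν := by
              rw [div_le_div_iff₀ (by linarith) hsν, one_mul]
              refine Real.sqrt_le_iff.2 ⟨by positivity, ?_⟩
              rw [mul_pow, Real.sq_sqrt (by positivity)]
              linarith
            linarith
        have := mul_le_mul_of_nonneg_left key hc0
        rw [show c / Real.sqrt (k + 1) = c * (1 / Real.sqrt (k + 1)) by ring]
        linarith)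
    refine le_trans ?_ h
    rw [integral_const_mul, integral_sub (integrable_const _) hadd, integral_const_mul,
      integral_add (integrable_const _) hti]
    simp only [integral_const, probReal_univ, smul_eq_mul, one_mul]
    gcongr
  have hx : 0 ≤ Real.exp (-((ν : ℝ) / 8)) := Real.exp_nonneg _
  have hE1 : 1 ≤ Real.exp (M ^ 2 * β ^ 2 / ν) := Real.one_le_exp (by positivity)
  have hs : 0 ≤ 2 / Real.sqrt ν := by positivity
  have h1 : Real.exp (-((ν : ℝ) / 8)) ≤ Real.exp (β * M) * Real.exp (-((ν : ℝ) / 8)) * e0 := by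
    nlinarith
  have h2 : 0 ≤ c * (2 / Real.sqrt ν + Real.exp (-(ν / 8))) * e0 := by positivity
  have h3 : 0 ≤ (Real.exp (M ^ 2 * β ^ 2 / ν) - 1) * e0 :=
    mul_nonneg (by linarith) he0pos.le
  rw [abs_le]
  constructor <;> nlinarith

end Sampling

/-- With `β = b log s` and `ν = s ^ α`, the relative sampling error is `O(s ^ (-α/4))`. -/
theorem exists_relative_error_le {b α M : ℝ} (hb : 0 < b) (hα : 0 < α) :
    ∃ C : ℝ, 0 ≤ C ∧ ∀ s : ℝ, 1 ≤ s →
      (Real.exp (M ^ 2 * (b * Real.log s) ^ 2 / s ^ α) - 1 +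
          Real.exp (b * Real.log s * M) * Real.exp (-(s ^ α / 8))) +
        2 * Real.exp (M ^ 2 / 2) * (b * Real.log s) *
          (2 / Real.sqrt (s ^ α) + Real.exp (-(s ^ α / 8))) ≤ C * s ^ (-(α / 4)) := by
  -- `n` is the number of powers `s ^ (-α)` to extract from `exp (-s ^ α / 8)` so as to beat `exp (β
  -- M) = s ^ (b M)` with `s ^ (-α/4)` to spare.
  obtain ⟨n, hn⟩ := exists_nat_ge ((b * M + α / 4) / α)
  rw [div_le_iff₀ hα] at hn
  set c1 := M ^ 2 * b ^ 2 * (8 / α) ^ 2 with hc1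
  refine ⟨c1 * Real.exp c1 + n.factorial * 8 ^ n +
    2 * Real.exp (M ^ 2 / 2) * b * (4 / α) * (2 + 8), by positivity, fun s hs => ?_⟩
  have hs0 : 0 < s := by linarith
  have hlog : 0 ≤ Real.log s := Real.log_nonneg hs
  -- The exponents are chosen so that both `log s ^ 2` and `log s`, in the terms where they occur,
  -- cost a factor `s ^ (α / 4)`.
  have hl8 : Real.log s ≤ (8 / α) * s ^ (α / 8) := by
    refine (Real.log_le_rpow_div hs0.le (by positivity : 0 < α / 8)).trans (le_of_eq ?_)
    field_simp
  have hl4 : Real.log s ≤ (4 / α) * s ^ (α / 4) := by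
    refine (Real.log_le_rpow_div hs0.le (by positivity : 0 < α / 4)).trans (le_of_eq ?_)
    field_simp
  have hexp : ∀ k : ℕ, Real.exp (-(s ^ α / 8)) ≤ k.factorial * 8 ^ k * s ^ (-(α * k)) := by
    intro k
    have h := Real.pow_div_factorial_le_exp (s ^ α / 8) (by positivity) k
    rw [Real.exp_neg, Real.rpow_neg hs0.le, Real.rpow_mul hs0.le, Real.rpow_natCast,
      ← div_eq_mul_inv, inv_le_comm₀ (Real.exp_pos _) (by positivity)]
    refine le_trans (le_of_eq ?_) h
    rw [div_pow]
    field_simp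
  have ha : Real.exp (M ^ 2 * (b * Real.log s) ^ 2 / s ^ α) - 1 ≤
      c1 * Real.exp c1 * s ^ (-(α / 4)) := by
    set x := M ^ 2 * (b * Real.log s) ^ 2 / s ^ α with hx
    have hx0 : 0 ≤ x := by positivity
    have hxle : x ≤ c1 * s ^ (-(α / 4)) := by
      have h2 : Real.log s ^ 2 ≤ ((8 / α) * s ^ (α / 8)) ^ 2 := by gcongr
      have e1 : (s ^ (α / 8)) ^ 2 = s ^ (α / 4) := by
        rw [← Real.rpow_natCast, ← Real.rpow_mul hs0.le]; congr 1; push_cast; ring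
      have e2 : s ^ (α / 4) / s ^ α ≤ s ^ (-(α / 4)) := by
        rw [← Real.rpow_sub hs0]
        exact Real.rpow_le_rpow_of_exponent_le hs (by linarith)
      calc x = M ^ 2 * b ^ 2 * (Real.log s ^ 2 / s ^ α) := by rw [hx]; ring
        _ ≤ M ^ 2 * b ^ 2 * (((8 / α) * s ^ (α / 8)) ^ 2 / s ^ α) := by gcongr
        _ = c1 * (s ^ (α / 4) / s ^ α) := by rw [mul_pow, e1, hc1]; ring
        _ ≤ _ := by gcongr
    have hxc : x ≤ c1 := hxle.trans (mul_le_of_le_one_right (by positivity)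
      (Real.rpow_le_one_of_one_le_of_nonpos hs (by linarith)))
    have h1 : Real.exp x - 1 ≤ x * Real.exp x := by
      have := Real.add_one_le_exp (-x)
      have h3 : Real.exp (-x) * Real.exp x = 1 := by rw [← Real.exp_add]; simp
      nlinarith [Real.exp_pos x]
    calc _ ≤ x * Real.exp x := h1
      _ ≤ (c1 * s ^ (-(α / 4))) * Real.exp c1 := by gcongr
      _ = _ := by ring
  have hbt : Real.exp (b * Real.log s * M) * Real.exp (-(s ^ α / 8)) ≤
      n.factorial * 8 ^ n * s ^ (-(α / 4)) := by
    have e1 : Real.exp (b * Real.log s * M) = s ^ (b * M) := by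
      rw [Real.rpow_def_of_pos hs0]; congr 1; ring
    rw [e1]
    calc _ ≤ s ^ (b * M) * (n.factorial * 8 ^ n * s ^ (-(α * n))) := by
          gcongr; exact hexp n
      _ = n.factorial * 8 ^ n * s ^ (b * M + -(α * n)) := by rw [Real.rpow_add hs0]; ring
      _ ≤ _ := by
        gcongr 1
        exact Real.rpow_le_rpow_of_exponent_le hs (by linarith)
  have hct : 2 * Real.exp (M ^ 2 / 2) * (b * Real.log s) *
          (2 / Real.sqrt (s ^ α) + Real.exp (-(s ^ α / 8))) ≤
      2 * Real.exp (M ^ 2 / 2) * b * (4 / α) * (2 + 8) * s ^ (-(α / 4)) := by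
    have e1 : 2 / Real.sqrt (s ^ α) = 2 * s ^ (-(α / 2)) := by
      rw [Real.sqrt_eq_rpow, ← Real.rpow_mul hs0.le, Real.rpow_neg hs0.le]
      rw [show α * (1 / 2) = α / 2 by ring]; rfl
    have e2 : Real.exp (-(s ^ α / 8)) ≤ 8 * s ^ (-(α / 2)) := by
      refine (hexp 1).trans ?_
      simp only [Nat.factorial_one, Nat.cast_one, one_mul, pow_one, mul_one]
      gcongr 1
      exact Real.rpow_le_rpow_of_exponent_le hs (by linarith)
    rw [e1]
    calc _ ≤ 2 * Real.exp (M ^ 2 / 2) * (b * ((4 / α) * s ^ (α / 4))) *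
          (2 * s ^ (-(α / 2)) + 8 * s ^ (-(α / 2))) := by gcongr
      _ = 2 * Real.exp (M ^ 2 / 2) * b * (4 / α) * (2 + 8) * (s ^ (α / 4) * s ^ (-(α / 2))) := by
          ring
      _ = _ := by rw [← Real.rpow_add hs0]; congr 2; ring
  nlinarith

/-- A bounded intensity makes the series dominated, uniformly in `t`, by the exponential series `R ^
n / n!`. Continuity in time is what later turns the integral equation for the law into a
differential one. -/
theorem continuousOn_integral_poisson {a : ℕ → ℝ → ℝ} {ν : ℝ → ℝ≥0} {s : Set ℝ}
    (ha : ∀ k, ContinuousOn (a k) s) (hν : ContinuousOn ν s) {R : ℝ} (hR : ∀ t ∈ s, (ν t : ℝ) ≤ R)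
    (h1 : ∀ k, ∀ t ∈ s, |a k t| ≤ 1) :
    ContinuousOn (fun t => ∫ k, a k t ∂(ProbabilityTheory.poissonMeasure (ν t))) s := by
  simp only [ProbabilityTheory.integral_poissonMeasure, smul_eq_mul]
  have hν' : ContinuousOn (fun t => (ν t : ℝ)) s := NNReal.continuous_coe.comp_continuousOn hν
  refine continuousOn_tsum (u := fun n : ℕ => R ^ n / n.factorial) (fun k => ?_)
    (Real.summable_pow_div_factorial R) (fun k t ht => ?_)
  · exact ((hν'.neg.rexp.mul (hν'.pow k)).div_const _).mul (ha k)
  · have hR0 : 0 ≤ R := (ν t).coe_nonneg.trans (hR t ht)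
    rw [Real.norm_eq_abs, abs_mul, abs_of_nonneg (by positivity)]
    have e : Real.exp (-(ν t : ℝ)) ≤ 1 := Real.exp_le_one_iff.2 (by simp)
    calc _ ≤ 1 * R ^ k / k.factorial * 1 := by
          have := hR t ht
          have := h1 k t ht
          gcongr
      _ = _ := by ring

/-! ### Noisy and Metropolis acceptance probabilities -/

namespace NoisyProblem

theorem expNeg_nonneg (β : ℝ) (r : ℝ≥0∞) : 0 ≤ expNeg β r := by
  unfold expNeg; split_ifs
  · exact le_rfl
  · exact Real.exp_nonneg _

theorem expNeg_le_one {β : ℝ} (hβ : 0 ≤ β) (r : ℝ≥0∞) : expNeg β r ≤ 1 := by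
  unfold expNeg; split_ifs
  · exact zero_le_one
  · rw [Real.exp_le_one_iff]; have := r.toReal_nonneg; nlinarith

theorem measurable_expNeg (β : ℝ) : Measurable (expNeg β) := by
  unfold expNeg
  exact Measurable.ite (measurableSet_singleton ⊤) measurable_const (by fun_prop)

theorem continuous_expNeg (r : ℝ≥0∞) : Continuous fun β => expNeg β r := by
  unfold expNeg; split_ifs <;> fun_prop

variable {E Ω : Type*} [Fintype E] [DecidableEq E] [MeasurableSpace Ω] (P : NoisyProblem E Ω)

theorem isProbabilityMeasure_pairNoise (x y : E) : IsProbabilityMeasure (P.pairNoise x y) := by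
  have := P.noise_prob x
  rw [← P.pairNoise_fst x y] at this
  exact Measure.isProbabilityMeasure_of_map Prod.fst

/-- The estimated positive part of the cost difference, with `k + 1` samples. -/
noncomputable def excess (x y : E) (k : ℕ) (ω : Fin (k + 1) → Ω × Ω) : ℝ≥0∞ :=
  ((∑ i, P.U y (ω i).2) - ∑ i, P.U x (ω i).1) / ((k + 1 : ℕ) : ℝ≥0∞)

theorem measurable_excess (x y : E) (k : ℕ) : Measurable (P.excess x y k) := by
  have := P.U_measurable
  unfold excess
  fun_prop

theorem acceptProb_eq (β : ℝ) (ν : ℝ≥0) (x y : E) :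
    P.acceptProb β ν x y = ∫ k : ℕ, (∫ ω : Fin (k + 1) → Ω × Ω, expNeg β (P.excess x y k ω)
      ∂(Measure.pi fun _ => P.pairNoise x y)) ∂(ProbabilityTheory.poissonMeasure ν) := rfl

theorem acceptance_nonneg (β : ℝ) (x y : E) (k : ℕ) :
    0 ≤ ∫ ω : Fin (k + 1) → Ω × Ω, expNeg β (P.excess x y k ω)
      ∂(Measure.pi fun _ => P.pairNoise x y) :=
  integral_nonneg fun _ => expNeg_nonneg _ _

theorem acceptance_le_one {β : ℝ} (hβ : 0 ≤ β) (x y : E) (k : ℕ) :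
    ∫ ω : Fin (k + 1) → Ω × Ω, expNeg β (P.excess x y k ω)
      ∂(Measure.pi fun _ => P.pairNoise x y) ≤ 1 := by
  have := P.isProbabilityMeasure_pairNoise x y
  have h := norm_integral_le_of_norm_le_const (μ := Measure.pi fun _ : Fin (k + 1) => P.pairNoise x y)
    (f := fun ω => expNeg β (P.excess x y k ω)) (C := 1) (ae_of_all _ fun ω => by
      rw [Real.norm_eq_abs, abs_of_nonneg (expNeg_nonneg _ _)]; exact expNeg_le_one hβ _)
  rw [probReal_univ, mul_one] at h
  exact (le_abs_self _).trans h

theorem acceptProb_nonneg (β : ℝ) (ν : ℝ≥0) (x y : E) : 0 ≤ P.acceptProb β ν x y :=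
  integral_nonneg fun k => P.acceptance_nonneg β x y k

theorem acceptProb_le_one {β : ℝ} (hβ : 0 ≤ β) (ν : ℝ≥0) (x y : E) : P.acceptProb β ν x y ≤ 1 := by
  rw [acceptProb_eq]
  have h := integral_mono (integrable_poisson_of_mem_Icc (P.acceptance_nonneg β x y)
    (P.acceptance_le_one hβ x y) ν) (integrable_const 1) (P.acceptance_le_one hβ x y)
  simpa using h

theorem continuousOn_acceptProb {β : ℝ → ℝ} {ν : ℝ → ℝ≥0} {s : Set ℝ} (hβ : ContinuousOn β s)
    (hβ0 : ∀ t ∈ s, 0 ≤ β t) (hν : ContinuousOn ν s) {R : ℝ} (hR : ∀ t ∈ s, (ν t : ℝ) ≤ R)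
    (x y : E) : ContinuousOn (fun t => P.acceptProb (β t) (ν t) x y) s := by
  have := P.isProbabilityMeasure_pairNoise x y
  refine continuousOn_integral_poisson (a := fun k t => ∫ ω : Fin (k + 1) → Ω × Ω,
    expNeg (β t) (P.excess x y k ω) ∂(Measure.pi fun _ => P.pairNoise x y))
    (fun k => ?_) hν hR (fun k t ht => ?_)
  · refine continuousOn_of_dominated (bound := fun _ => 1) (fun t _ => ?_)
      (fun t ht => ae_of_all _ fun ω => ?_) (integrable_const _) (ae_of_all _ fun ω => ?_)
    · exact ((measurable_expNeg _).comp (P.measurable_excess x y k)).aestronglyMeasurable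
    · rw [Real.norm_eq_abs, abs_of_nonneg (expNeg_nonneg _ _)]; exact expNeg_le_one (hβ0 t ht) _
    · exact (continuous_expNeg _).comp_continuousOn hβ
  · rw [abs_of_nonneg (P.acceptance_nonneg _ x y k)]
    exact P.acceptance_le_one (hβ0 t ht) x y k

theorem J_eq_top {x : E} (hx : x ∉ P.admissible) : P.J x = ⊤ := by
  have := P.noise_prob x
  simp [J, P.U_infinite x hx]

theorem U_ne_top {x : E} (hx : x ∈ P.admissible) (ω : Ω) : P.U x ω ≠ ⊤ := by
  obtain ⟨M, hM⟩ := P.U_bounded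
  exact ne_top_of_le_ne_top ENNReal.coe_ne_top (hM x hx ω)

theorem J_ne_top {x : E} (hx : x ∈ P.admissible) : P.J x ≠ ⊤ := by
  have := P.noise_prob x
  obtain ⟨M, hM⟩ := P.U_bounded
  refine ne_top_of_le_ne_top (ENNReal.coe_ne_top (r := M)) ?_
  calc P.J x ≤ ∫⁻ _, M ∂(P.noise x) := lintegral_mono fun ω => hM x hx ω
    _ = M := by simp

theorem J_toReal {x : E} (hx : x ∈ P.admissible) :
    (P.J x).toReal = ∫ ω, (P.U x ω).toReal ∂(P.noise x) := by
  rw [J, integral_toReal (P.U_measurable x).aemeasurable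
    (ae_of_all _ fun ω => (P.U_ne_top hx ω).lt_top)]

/-- Every sample of the candidate's cost is infinite while the current cost stays finite, so the
move is always refused: the dynamics never leaves `E'`. -/
theorem acceptProb_eq_zero {x y : E} (hx : x ∈ P.admissible) (hy : y ∉ P.admissible) (β : ℝ)
    (ν : ℝ≥0) : P.acceptProb β ν x y = 0 := by
  rw [acceptProb_eq]
  refine integral_eq_zero_of_ae (ae_of_all _ fun k => ?_)
  refine integral_eq_zero_of_ae (ae_of_all _ fun ω => ?_)
  have h1 : ∑ i, P.U y (ω i).2 = ⊤ := by
    simp [P.U_infinite y hy]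
  have h2 : ∑ i, P.U x (ω i).1 ≠ ⊤ := ENNReal.sum_ne_top.2 fun i _ => P.U_ne_top hx _
  have : P.excess x y k ω = ⊤ := by
    rw [excess, h1, ENNReal.top_sub h2, ENNReal.top_div_of_ne_top (ENNReal.natCast_ne_top _)]
  simp [this, expNeg]

/-- The difference of the noisy costs of two admissible states. -/
noncomputable def costDiff (x y : E) (ω : Ω × Ω) : ℝ := (P.U y ω.2).toReal - (P.U x ω.1).toReal

theorem measurable_costDiff (x y : E) : Measurable (P.costDiff x y) := by
  have := P.U_measurable
  unfold costDiff
  fun_prop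

/-- By linearity only the marginals of the joint law matter, so arbitrary coupling of the two
evaluations is allowed. -/
theorem integral_costDiff {x y : E} (hx : x ∈ P.admissible) (hy : y ∈ P.admissible) :
    ∫ ω, P.costDiff x y ω ∂(P.pairNoise x y) = (P.J y).toReal - (P.J x).toReal := by
  have := P.isProbabilityMeasure_pairNoise x y
  obtain ⟨M, hM⟩ := P.U_bounded
  have hUm := P.U_measurable
  have hb : ∀ z ∈ P.admissible, ∀ ω, ‖(P.U z ω).toReal‖ ≤ M := fun z hz ω => by
    rw [Real.norm_eq_abs, abs_of_nonneg ENNReal.toReal_nonneg]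
    exact ENNReal.toReal_le_of_le_ofReal M.coe_nonneg (by simpa using hM z hz ω)
  rw [P.J_toReal hx, P.J_toReal hy]
  unfold costDiff
  rw [integral_sub, ← P.pairNoise_fst x y]
  · congr 1
    · rw [← P.pairNoise_snd x y, integral_map measurable_snd.aemeasurable]
      exact (hUm y).ennreal_toReal.aestronglyMeasurable
    · rw [integral_map measurable_fst.aemeasurable]
      exact (hUm x).ennreal_toReal.aestronglyMeasurable
  · exact Integrable.of_bound (Measurable.aestronglyMeasurable (by fun_prop)) M
      (ae_of_all _ fun ω => hb y hy _)
  · exact Integrable.of_bound (Measurable.aestronglyMeasurable (by fun_prop)) M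
      (ae_of_all _ fun ω => hb x hx _)

/-- Both sums of costs are finite, so the truncated subtraction of `[0, ∞]` is the positive part of
a real difference and the Hoeffding estimates apply. -/
theorem expNeg_excess {x y : E} (hx : x ∈ P.admissible) (hy : y ∈ P.admissible) (β : ℝ) (k : ℕ)
    (ω : Fin (k + 1) → Ω × Ω) : expNeg β (P.excess x y k ω) =
      Real.exp (-(β * (max 0 (∑ i, P.costDiff x y (ω i)) / (k + 1 : ℝ)))) := by
  have h1 : ∑ i, P.U y (ω i).2 ≠ ⊤ := ENNReal.sum_ne_top.2 fun i _ => P.U_ne_top hy _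
  have h2 : ∑ i, P.U x (ω i).1 ≠ ⊤ := ENNReal.sum_ne_top.2 fun i _ => P.U_ne_top hx _
  have h3 : P.excess x y k ω ≠ ⊤ :=
    ENNReal.div_ne_top (ENNReal.sub_ne_top h1) (by positivity)
  have h4 : (∑ i, P.costDiff x y (ω i)) =
      (∑ i, P.U y (ω i).2).toReal - (∑ i, P.U x (ω i).1).toReal := by
    rw [ENNReal.toReal_sum fun i _ => P.U_ne_top hy _, ENNReal.toReal_sum fun i _ => P.U_ne_top hx _,
      ← Finset.sum_sub_distrib]
    rfl
  rw [expNeg, if_neg h3, h4]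
  congr 3
  rw [excess, ENNReal.toReal_div]
  congr 1
  · rcases le_total (∑ i, P.U x (ω i).1) (∑ i, P.U y (ω i).2) with h | h
    · rw [ENNReal.toReal_sub_of_le h h1, max_eq_right]
      exact sub_nonneg.2 (ENNReal.toReal_mono h1 h)
    · rw [tsub_eq_zero_of_le h, max_eq_left]
      · rfl
      · exact sub_nonpos.2 (ENNReal.toReal_mono h2 h)
  · rw [ENNReal.toReal_natCast]; push_cast; rfl

/-- The noisy acceptance probability is relatively close to the Metropolis one. -/
theorem exists_abs_acceptProb_sub_le {b α : ℝ} (hb : 0 < b) (hα : 0 < α) :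
    ∃ C : ℝ, 0 ≤ C ∧ ∀ x ∈ P.admissible, ∀ y ∈ P.admissible, ∀ s : ℝ, 1 ≤ s →
      |P.acceptProb (b * Real.log s) (s ^ α).toNNReal x y -
          Real.exp (-(b * Real.log s * max 0 ((P.J y).toReal - (P.J x).toReal)))| ≤
        C * s ^ (-(α / 4)) *
          Real.exp (-(b * Real.log s * max 0 ((P.J y).toReal - (P.J x).toReal))) := by
  obtain ⟨M, hM⟩ := P.U_bounded
  obtain ⟨C, hC, hCs⟩ := exists_relative_error_le (M := M) hb hα
  refine ⟨C, hC, fun x hx y hy s hs => ?_⟩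
  have := P.isProbabilityMeasure_pairNoise x y
  have hb' : ∀ z ∈ P.admissible, ∀ ω, (P.U z ω).toReal ≤ M := fun z hz ω =>
    ENNReal.toReal_le_of_le_ofReal M.coe_nonneg (by simpa using hM z hz ω)
  have hYb : ∀ ω, |P.costDiff x y ω| ≤ M := fun ω => by
    have h1 := hb' y hy ω.2
    have h2 := hb' x hx ω.1
    have h3 : 0 ≤ (P.U y ω.2).toReal := ENNReal.toReal_nonneg
    have h4 : 0 ≤ (P.U x ω.1).toReal := ENNReal.toReal_nonneg
    rw [costDiff, abs_le]
    constructor <;> linarith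
  have hs0 : 0 < s ^ α := Real.rpow_pos_of_pos (by linarith) _
  have h := abs_integral_sampledAccept_sub_le (μ := P.pairNoise x y) (P.measurable_costDiff x y) hYb
    (mul_nonneg hb.le (Real.log_nonneg hs)) (ν := (s ^ α).toNNReal) (Real.toNNReal_pos.2 hs0)
  rw [P.integral_costDiff hx hy, Real.coe_toNNReal _ hs0.le] at h
  have e : P.acceptProb (b * Real.log s) (s ^ α).toNNReal x y =
      ∫ k, sampledAccept (P.pairNoise x y) (P.costDiff x y) (b * Real.log s) k
        ∂(ProbabilityTheory.poissonMeasure (s ^ α).toNNReal) := by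
    rw [acceptProb_eq]
    simp only [P.expNeg_excess hx hy, sampledAccept]
  rw [e]
  exact h.trans (mul_le_mul_of_nonneg_right (hCs s hs) (Real.exp_nonneg _))

end NoisyProblem

/-! ### Poincaré inequality and dissipation on a reversible landscape -/

/-- A finite reversible proposition chain with energies, given as exponents `θ = b (J - J⋆)`. -/
structure EnergyLandscape (V : Type*) [Fintype V] where
  /-- the reference weights -/
  mu : V → ℝ
  mu_pos : ∀ x, 0 < mu x
  mu_sum : ∑ x, mu x ≤ 1
  /-- the proposition rates -/
  q : V → V → ℝ
  q_nonneg : ∀ x y, 0 ≤ q x y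
  q_sum : ∀ x, ∑ y, q x y ≤ 1
  reversible : ∀ x y, mu x * q x y = mu y * q y x
  /-- the energy exponents -/
  θ : V → ℝ
  θ_nonneg : ∀ x, 0 ≤ θ x
  /-- a ground state -/
  ground : V
  θ_ground : θ ground = 0

namespace EnergyLandscape

variable {V : Type*} [Fintype V] (L : EnergyLandscape V)

/-- The unnormalized Gibbs weight at `s = exp (β / b)`. -/
noncomputable def weight (s : ℝ) (x : V) : ℝ := L.mu x * s ^ (-L.θ x)

/-- The partition function. -/
noncomputable def partition (s : ℝ) : ℝ := ∑ x, L.weight s x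

/-- The Metropolis rate. -/
noncomputable def rate (s : ℝ) (x y : V) : ℝ := L.q x y * s ^ (-max 0 (L.θ y - L.θ x))

/-- The conductance of the Metropolis dynamics. -/
noncomputable def conductance (s : ℝ) (x y : V) : ℝ :=
  L.mu x * L.q x y * s ^ (-max (L.θ x) (L.θ y))

/-- Twice the Dirichlet form. -/
noncomputable def dirichlet (s : ℝ) (f : V → ℝ) : ℝ :=
  ∑ x, ∑ y, L.conductance s x y * (f y - f x) ^ 2

theorem weight_pos {s : ℝ} (hs : 0 < s) (x : V) : 0 < L.weight s x :=
  mul_pos (L.mu_pos x) (Real.rpow_pos_of_pos hs _)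

theorem mu_le_one (x : V) : L.mu x ≤ 1 :=
  (Finset.single_le_sum (fun y _ => (L.mu_pos y).le) (Finset.mem_univ x)).trans L.mu_sum

theorem mu_ground_le_partition {s : ℝ} (hs : 0 < s) : L.mu L.ground ≤ L.partition s := by
  have h := Finset.single_le_sum (fun y _ => (L.weight_pos hs y).le) (Finset.mem_univ L.ground)
  rwa [weight, L.θ_ground, neg_zero, Real.rpow_zero, mul_one] at h

theorem partition_pos {s : ℝ} (hs : 0 < s) : 0 < L.partition s :=
  (L.mu_pos _).trans_le (L.mu_ground_le_partition hs)

theorem conductance_nonneg {s : ℝ} (hs : 0 < s) (x y : V) : 0 ≤ L.conductance s x y :=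
  mul_nonneg (mul_nonneg (L.mu_pos x).le (L.q_nonneg x y)) (Real.rpow_pos_of_pos hs _).le

theorem rate_nonneg {s : ℝ} (hs : 0 < s) (x y : V) : 0 ≤ L.rate s x y :=
  mul_nonneg (L.q_nonneg x y) (Real.rpow_pos_of_pos hs _).le

theorem rate_sum_le_one {s : ℝ} (hs : 1 ≤ s) (x : V) : ∑ y, L.rate s x y ≤ 1 := by
  refine le_trans (Finset.sum_le_sum fun y _ => ?_) (L.q_sum x)
  exact mul_le_of_le_one_right (L.q_nonneg x y)
    (Real.rpow_le_one_of_one_le_of_nonpos hs (neg_nonpos.2 (le_max_left _ _)))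

theorem conductance_symm (s : ℝ) (x y : V) : L.conductance s x y = L.conductance s y x := by
  rw [conductance, conductance, L.reversible, max_comm]

/-- Detailed balance: the right-hand side is symmetric in `x` and `y`, so the Metropolis dynamics is
reversible for the Gibbs weights. -/
theorem weight_mul_rate {s : ℝ} (hs : 0 < s) (x y : V) :
    L.weight s x * L.rate s x y = L.conductance s x y := by
  rw [weight, rate, conductance]
  have : -max (L.θ x) (L.θ y) = -L.θ x + -max 0 (L.θ y - L.θ x) := by
    rcases le_total (L.θ x) (L.θ y) with h | h
    · rw [max_eq_right h, max_eq_right (by linarith)]; ring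
    · rw [max_eq_left h, max_eq_left (by linarith)]; ring
  rw [this, Real.rpow_add hs]
  ring

theorem dirichlet_nonneg {s : ℝ} (hs : 0 < s) (f : V → ℝ) : 0 ≤ L.dirichlet s f :=
  Finset.sum_nonneg fun x _ => Finset.sum_nonneg fun y _ =>
    mul_nonneg (L.conductance_nonneg hs x y) (sq_nonneg _)

/-- One proposition step below the level `H`. -/
def StepBelow (H : ℝ) (x y : V) : Prop := 0 < L.q x y ∧ L.θ x ≤ H ∧ L.θ y ≤ H

/-- An edge below level `H` has conductance at least `μ q s ^ (-H)`, so its single term of the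
Dirichlet form already controls the increment of `f`. -/
theorem abs_sub_le_of_stepBelow {H : ℝ} {x y : V} (h : L.StepBelow H x y) {s : ℝ} (hs : 1 ≤ s)
    (f : V → ℝ) : |f y - f x| ≤
      Real.sqrt (1 / (L.mu x * L.q x y)) * Real.sqrt (s ^ H * L.dirichlet s f) := by
  have hs0 : 0 < s := by linarith
  obtain ⟨hq, hx, hy⟩ := h
  have hk : 0 < L.mu x * L.q x y := mul_pos (L.mu_pos x) hq
  rw [← Real.sqrt_mul (by positivity)]
  refine Real.abs_le_sqrt ?_
  have h1 : L.conductance s x y * (f y - f x) ^ 2 ≤ L.dirichlet s f :=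
    le_trans (Finset.single_le_sum (f := fun y => L.conductance s x y * (f y - f x) ^ 2)
      (fun z _ => mul_nonneg (L.conductance_nonneg hs0 x z) (sq_nonneg _)) (Finset.mem_univ y))
      (Finset.single_le_sum (f := fun x => ∑ y, L.conductance s x y * (f y - f x) ^ 2)
        (fun z _ => Finset.sum_nonneg fun y _ =>
          mul_nonneg (L.conductance_nonneg hs0 z y) (sq_nonneg _)) (Finset.mem_univ x))
  have h2 : 1 ≤ s ^ H * s ^ (-max (L.θ x) (L.θ y)) := by
    rw [← Real.rpow_add hs0]
    exact Real.one_le_rpow hs (by have := max_le hx hy; linarith)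
  rw [one_div, inv_mul_eq_div, le_div_iff₀ hk]
  calc (f y - f x) ^ 2 * (L.mu x * L.q x y)
      ≤ (f y - f x) ^ 2 * (L.mu x * L.q x y) * (s ^ H * s ^ (-max (L.θ x) (L.θ y))) :=
        le_mul_of_one_le_right (by positivity) h2
    _ = s ^ H * (L.conductance s x y * (f y - f x) ^ 2) := by rw [conductance]; ring
    _ ≤ _ := by gcongr

/-- Increments add up along the path. The constant depends on the path only, not on the temperature
or on `f`. -/
theorem exists_abs_sub_le_of_path {H : ℝ} {x y : V}
    (h : Relation.ReflTransGen (L.StepBelow H) x y) :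
    ∃ C : ℝ, 0 ≤ C ∧ ∀ s : ℝ, 1 ≤ s → ∀ f : V → ℝ,
      |f y - f x| ≤ C * Real.sqrt (s ^ H * L.dirichlet s f) := by
  induction h with
  | refl => exact ⟨0, le_rfl, fun s _ f => by simp⟩
  | @tail u v _ huv ih =>
    obtain ⟨C, hC, h⟩ := ih
    refine ⟨C + Real.sqrt (1 / (L.mu u * L.q u v)), by positivity, fun s hs f => ?_⟩
    rw [add_mul]
    have h1 := h s hs f
    have h2 := L.abs_sub_le_of_stepBelow huv hs f
    have h3 := abs_add_le (f v - f u) (f u - f x)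
    rw [sub_add_sub_cancel] at h3
    linarith

/-- Any two states are joined by a path whose elevation above the higher one is at most `a`. -/
def DepthLE (a : ℝ) : Prop :=
  ∀ x y, ∃ H, H ≤ a + max (L.θ x) (L.θ y) ∧ Relation.ReflTransGen (L.StepBelow H) x y

/-- The variance as half of a double sum of squared increments, the form to which path estimates
apply. -/
theorem partition_mul_sum_sub_sq (s : ℝ) (f : V → ℝ) :
    L.partition s * ∑ x, L.weight s x * f x ^ 2 - (∑ x, L.weight s x * f x) ^ 2 =
      (∑ x, ∑ y, L.weight s x * L.weight s y * (f y - f x) ^ 2) / 2 := by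
  have h1 : L.partition s * ∑ x, L.weight s x * f x ^ 2 =
      ∑ x, ∑ y, L.weight s x * L.weight s y * f y ^ 2 := by
    rw [partition, Finset.sum_mul_sum]
    refine Finset.sum_congr rfl fun x _ => Finset.sum_congr rfl fun y _ => by ring
  have h2 : ∑ x, ∑ y, L.weight s x * L.weight s y * f y ^ 2 =
      ∑ x, ∑ y, L.weight s x * L.weight s y * f x ^ 2 := by
    rw [Finset.sum_comm]
    refine Finset.sum_congr rfl fun x _ => Finset.sum_congr rfl fun y _ => by ring
  have h3 : (∑ x, L.weight s x * f x) ^ 2 =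
      ∑ x, ∑ y, L.weight s x * L.weight s y * (f x * f y) := by
    rw [sq, Finset.sum_mul_sum]
    refine Finset.sum_congr rfl fun x _ => Finset.sum_congr rfl fun y _ => by ring
  have h4 : ∑ x, ∑ y, L.weight s x * L.weight s y * (f y - f x) ^ 2 =
      ∑ x, ∑ y, L.weight s x * L.weight s y * f y ^ 2 +
      ∑ x, ∑ y, L.weight s x * L.weight s y * f x ^ 2 -
      2 * ∑ x, ∑ y, L.weight s x * L.weight s y * (f x * f y) := by
    simp only [Finset.mul_sum, ← Finset.sum_add_distrib, ← Finset.sum_sub_distrib]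
    refine Finset.sum_congr rfl fun x _ => Finset.sum_congr rfl fun y _ => by ring
  rw [h1, h3, h4, ← h2]
  ring

/-- The Poincaré inequality of the Metropolis dynamics. -/
theorem exists_poincare {a : ℝ} (ha : L.DepthLE a) :
    ∃ K : ℝ, 0 < K ∧ ∀ s : ℝ, 1 ≤ s → ∀ f : V → ℝ,
      ∑ x, L.weight s x * f x ^ 2 - (∑ x, L.weight s x * f x) ^ 2 / L.partition s ≤
        K * s ^ a * L.dirichlet s f := by
  choose H hH hpath using ha
  choose C hC0 hC using fun x y => L.exists_abs_sub_le_of_path (hpath x y)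
  have hg := L.mu_pos L.ground
  refine ⟨(∑ x, ∑ y, C x y ^ 2) / 2 / L.mu L.ground + 1, ?_, fun s hs f => ?_⟩
  · have : 0 ≤ ∑ x, ∑ y, C x y ^ 2 :=
      Finset.sum_nonneg fun x _ => Finset.sum_nonneg fun y _ => sq_nonneg _
    positivity
  have hs0 : 0 < s := by linarith
  have hZ := L.partition_pos hs0
  have hD := L.dirichlet_nonneg hs0 f
  set D := L.dirichlet s f
  have hsa : 0 ≤ s ^ a := Real.rpow_nonneg hs0.le _
  have hterm : ∀ x y, L.weight s x * L.weight s y * (f y - f x) ^ 2 ≤ C x y ^ 2 * (s ^ a * D) := by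
    intro x y
    have h1 : (f y - f x) ^ 2 ≤ C x y ^ 2 * (s ^ H x y * D) := by
      have h := hC x y s hs f
      rw [← sq_abs]
      calc |f y - f x| ^ 2 ≤ (C x y * Real.sqrt (s ^ H x y * D)) ^ 2 := by gcongr
        _ = _ := by rw [mul_pow, Real.sq_sqrt (by positivity)]
    -- The exponent is at most `a + max (θ x) (θ y) - θ x - θ y = a - min (θ x) (θ y) ≤ a`: the
    -- depth is measured from the higher end because its weight pays for the climb to it.
    have h2 : L.weight s x * L.weight s y * s ^ H x y ≤ s ^ a := by
      have e : L.weight s x * L.weight s y * s ^ H x y =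
          L.mu x * L.mu y * s ^ (-L.θ x + -L.θ y + H x y) := by
        rw [Real.rpow_add hs0, Real.rpow_add hs0, weight, weight]; ring
      rw [e]
      have h3 : s ^ (-L.θ x + -L.θ y + H x y) ≤ s ^ a := by
        refine Real.rpow_le_rpow_of_exponent_le hs ?_
        have := hH x y
        have := L.θ_nonneg x
        have := L.θ_nonneg y
        rcases max_cases (L.θ x) (L.θ y) with h | h <;> linarith [h.1]
      have h4 : L.mu x * L.mu y ≤ 1 :=
        mul_le_one₀ (L.mu_le_one x) (L.mu_pos y).le (L.mu_le_one y)
      calc _ ≤ 1 * s ^ (-L.θ x + -L.θ y + H x y) := by gcongr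
        _ ≤ _ := by rw [one_mul]; exact h3
    have hw : 0 ≤ L.weight s x * L.weight s y :=
      mul_nonneg (L.weight_pos hs0 x).le (L.weight_pos hs0 y).le
    calc _ ≤ L.weight s x * L.weight s y * (C x y ^ 2 * (s ^ H x y * D)) := by gcongr
      _ = C x y ^ 2 * ((L.weight s x * L.weight s y * s ^ H x y) * D) := by ring
      _ ≤ _ := by gcongr
  have hsum : (∑ x, ∑ y, L.weight s x * L.weight s y * (f y - f x) ^ 2) ≤
      (∑ x, ∑ y, C x y ^ 2) * (s ^ a * D) := by
    rw [Finset.sum_mul]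
    refine Finset.sum_le_sum fun x _ => ?_
    rw [Finset.sum_mul]
    exact Finset.sum_le_sum fun y _ => hterm x y
  have hid := L.partition_mul_sum_sub_sq s f
  have e : ∑ x, L.weight s x * f x ^ 2 - (∑ x, L.weight s x * f x) ^ 2 / L.partition s =
      (L.partition s * ∑ x, L.weight s x * f x ^ 2 - (∑ x, L.weight s x * f x) ^ 2) /
        L.partition s := by field_simp
  rw [e, hid]
  have hS : 0 ≤ (∑ x, ∑ y, C x y ^ 2) * (s ^ a * D) := mul_nonneg
    (Finset.sum_nonneg fun x _ => Finset.sum_nonneg fun y _ => sq_nonneg _) (by positivity)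
  calc _ ≤ (∑ x, ∑ y, C x y ^ 2) * (s ^ a * D) / 2 / L.partition s := by gcongr
    _ ≤ (∑ x, ∑ y, C x y ^ 2) * (s ^ a * D) / 2 / L.mu L.ground := by
        gcongr
        exact L.mu_ground_le_partition hs0
    _ = (∑ x, ∑ y, C x y ^ 2) / 2 / L.mu L.ground * s ^ a * D := by ring
    _ ≤ _ := by
        gcongr
        linarith

/-- The energy `∑ m² / w` of a signed measure with respect to the Gibbs weights. -/
noncomputable def energy (s : ℝ) (m : V → ℝ) : ℝ := ∑ x, m x ^ 2 / L.weight s x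

/-- The dissipation of the energy along rates relatively close to the Metropolis ones. -/
theorem sum_master_le {s : ℝ} (hs : 1 ≤ s) {δ : ℝ} (m : V → ℝ) (c : V → V → ℝ)
    (hc : ∀ x y, |c x y - L.rate s x y| ≤ δ * L.rate s x y) :
    ∑ y, 2 * (m y / L.weight s y) * ∑ x, (m x * c x y - m y * c y x) ≤
      -(L.dirichlet s (fun x => m x / L.weight s x) / 2) + 2 * δ ^ 2 * L.energy s m := by
  have hs0 : 0 < s := by linarith
  set f : V → ℝ := fun x => m x / L.weight s x with hf
  have hm : ∀ x, m x = f x * L.weight s x := fun x => by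
    rw [hf]; simp only; rw [div_mul_cancel₀ _ (L.weight_pos hs0 x).ne']
  have h1 : ∑ y, 2 * (m y / L.weight s y) * ∑ x, (m x * c x y - m y * c y x) =
      2 * ∑ x, ∑ y, m x * c x y * (f y - f x) := by
    have e1 : ∑ y, 2 * (m y / L.weight s y) * ∑ x, (m x * c x y - m y * c y x) =
        2 * (∑ y, ∑ x, m x * c x y * f y) - 2 * ∑ y, ∑ x, m y * c y x * f y := by
      simp only [Finset.mul_sum, ← Finset.sum_sub_distrib]
      refine Finset.sum_congr rfl fun y _ => Finset.sum_congr rfl fun x _ => ?_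
      rw [hf]; ring
    rw [e1, Finset.sum_comm, ← mul_sub, ← Finset.sum_sub_distrib]
    congr 1
    refine Finset.sum_congr rfl fun x _ => ?_
    rw [← Finset.sum_sub_distrib]
    refine Finset.sum_congr rfl fun y _ => by ring
  -- Exchanging `x` and `y` and averaging, thanks to the symmetry of the conductance, produces the
  -- square.
  have hsymm : 2 * ∑ x, ∑ y, f x * L.conductance s x y * (f y - f x) = -L.dirichlet s f := by
    have e2 : ∑ x, ∑ y, f x * L.conductance s x y * (f y - f x) =
        ∑ x, ∑ y, f y * L.conductance s x y * (f x - f y) := by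
      rw [Finset.sum_comm]
      refine Finset.sum_congr rfl fun x _ => Finset.sum_congr rfl fun y _ => ?_
      rw [L.conductance_symm]
    rw [two_mul]
    nth_rewrite 2 [e2]
    rw [dirichlet, ← Finset.sum_add_distrib, ← Finset.sum_neg_distrib]
    refine Finset.sum_congr rfl fun x _ => ?_
    rw [← Finset.sum_add_distrib, ← Finset.sum_neg_distrib]
    refine Finset.sum_congr rfl fun y _ => by ring
  have hpt : ∀ x y, 2 * (m x * c x y * (f y - f x)) ≤
      2 * (f x * L.conductance s x y * (f y - f x)) + (L.conductance s x y * (f y - f x) ^ 2 / 2 +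
        2 * δ ^ 2 * (f x ^ 2 * L.weight s x * L.rate s x y)) := by
    intro x y
    have hr := L.rate_nonneg hs0 x y
    have hw := (L.weight_pos hs0 x).le
    rw [← L.weight_mul_rate hs0, hm x]
    set g := f y - f x
    have h2 : f x * g * (c x y - L.rate s x y) ≤ |f x * g| * (δ * L.rate s x y) :=
      (le_abs_self _).trans ((abs_mul _ _).le.trans
        (mul_le_mul_of_nonneg_left (hc x y) (abs_nonneg _)))
    -- Young's inequality with the weights that spend exactly half of the dissipation; the relative
    -- error then survives only through its square.
    have h3 : 2 * (|f x * g| * δ) ≤ g ^ 2 / 2 + 2 * δ ^ 2 * f x ^ 2 := by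
      rw [abs_mul]
      have := sq_nonneg (|g| - 2 * (δ * |f x|))
      have e3 : (|g| - 2 * (δ * |f x|)) ^ 2 = g ^ 2 - 4 * (|f x| * |g| * δ) + 4 * δ ^ 2 * f x ^ 2 := by
        rw [← sq_abs g, ← sq_abs (f x)]; ring
      linarith
    have h4 := mul_le_mul_of_nonneg_left h2 hw
    have h5 := mul_le_mul_of_nonneg_left h3 (mul_nonneg hw hr)
    nlinarith
  have hF : ∑ x, ∑ y, f x ^ 2 * L.weight s x * L.rate s x y ≤ L.energy s m := by
    refine Finset.sum_le_sum fun x _ => ?_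
    rw [← Finset.mul_sum]
    have e : m x ^ 2 / L.weight s x = f x ^ 2 * L.weight s x := by
      have := (L.weight_pos hs0 x).ne'
      rw [hm x]; field_simp
    rw [e]
    exact mul_le_of_le_one_right (mul_nonneg (sq_nonneg _) (L.weight_pos hs0 x).le)
      (L.rate_sum_le_one hs x)
  have hsum : 2 * ∑ x, ∑ y, m x * c x y * (f y - f x) ≤
      2 * ∑ x, ∑ y, f x * L.conductance s x y * (f y - f x) + (L.dirichlet s f / 2 +
        2 * δ ^ 2 * ∑ x, ∑ y, f x ^ 2 * L.weight s x * L.rate s x y) := by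
    simp only [dirichlet, Finset.mul_sum, Finset.sum_div, ← Finset.sum_add_distrib]
    exact Finset.sum_le_sum fun x _ => Finset.sum_le_sum fun y _ => hpt x y
  rw [h1]
  have : 2 * δ ^ 2 * ∑ x, ∑ y, f x ^ 2 * L.weight s x * L.rate s x y ≤
      2 * δ ^ 2 * L.energy s m := by gcongr
  linarith

end EnergyLandscape

/-! ### Comparison lemma and decay of the chi-square excess -/

/-- A comparison lemma for differential inequalities with polynomial coefficients. -/
theorem exists_le_rpow_of_deriv_le {G G' : ℝ → ℝ} {t₀ d a κ c A B₀ : ℝ} (hd : 0 < d) (hc : 0 < c)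
    (hA : 0 ≤ A) (hB₀ : 0 ≤ B₀) (haκ : a < κ) (hκ : κ ≤ 1) (ht₀ : 0 ≤ t₀)
    (hG : ∀ t, t₀ ≤ t → HasDerivAt G (G' t) t)
    (hG' : ∀ t, t₀ ≤ t → G' t ≤ -(c * (1 + t * d) ^ (-a) * G t) +
      A * (1 + t * d) ^ (-κ) * (G t + B₀)) :
    ∃ B : ℝ, 0 < B ∧ ∀ᶠ t in atTop, G t ≤ B * (1 + t * d) ^ (a - κ) := by
  have hs : Tendsto (fun t : ℝ => 1 + t * d) atTop atTop :=
    tendsto_atTop_add_const_left _ _ (tendsto_id.atTop_mul_const hd)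
  have hlim : ∀ e : ℝ, e < 0 → Tendsto (fun t : ℝ => (1 + t * d) ^ e) atTop (nhds 0) := by
    intro e he
    have := (tendsto_rpow_neg_atTop (neg_pos.2 he)).comp hs
    simpa [Function.comp_def] using this
  -- Beyond `t₁`, the growth term and the decay of the barrier each use less than a quarter of the
  -- damping `c`. Both exponents are negative because `a < κ ≤ 1`.
  have h1 : ∀ᶠ t : ℝ in atTop, A * (1 + t * d) ^ (a - κ) < c / 4 := by
    have := (hlim (a - κ) (by linarith)).const_mul A
    rw [mul_zero] at this
    exact this.eventually_lt_const (by positivity)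
  have h2 : ∀ᶠ t : ℝ in atTop, (κ - a) * d * (1 + t * d) ^ (a - 1) < c / 4 := by
    have := (hlim (a - 1) (by linarith)).const_mul ((κ - a) * d)
    rw [mul_zero] at this
    exact this.eventually_lt_const (by positivity)
  obtain ⟨t₁, ht₁⟩ := eventually_atTop.1 (h1.and h2)
  set t₂ := max t₀ t₁ with ht₂
  have ht₂0 : 0 ≤ t₂ := ht₀.trans (le_max_left _ _)
  have hspos : ∀ t, t₂ ≤ t → 0 < 1 + t * d := fun t ht => by
    have : 0 ≤ t * d := mul_nonneg (ht₂0.trans ht) hd.le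
    linarith
  set s₂ := (1 + t₂ * d) ^ (a - κ) with hs₂
  have hs₂0 : 0 < s₂ := Real.rpow_pos_of_pos (hspos t₂ le_rfl) _
  -- The first summand dominates the forcing `A B₀`, the second puts the barrier above `G` at `t₂`,
  -- and `1` keeps `B` positive.
  set B := 4 * A * B₀ / c + |G t₂| / s₂ + 1 with hB
  have hBpos : 0 < B := by positivity
  refine ⟨B, hBpos, eventually_atTop.2 ⟨t₂, fun t ht => ?_⟩⟩
  have hder : ∀ x, t₂ ≤ x → HasDerivAt (fun t : ℝ => B * (1 + t * d) ^ (a - κ))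
      (B * (d * (a - κ) * (1 + x * d) ^ (a - κ - 1))) x := by
    intro x hx
    have h : HasDerivAt (fun t : ℝ => 1 + t * d) d x := by
      simpa using ((hasDerivAt_id x).mul_const d).const_add 1
    exact (h.rpow_const (Or.inl (hspos x hx).ne')).const_mul B
  -- Derivatives need comparing only at points where `G` meets the barrier; there the barrier's
  -- value replaces `G` in the differential inequality.
  refine image_le_of_deriv_right_lt_deriv_boundary' (a := t₂) (b := t) (f := G) (f' := G')
    (B := fun t => B * (1 + t * d) ^ (a - κ))
    (B' := fun x => B * (d * (a - κ) * (1 + x * d) ^ (a - κ - 1)))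
    ?_ ?_ ?_ ?_ ?_ ?_ ⟨ht, le_rfl⟩
  · exact fun x hx => (hG x ((le_max_left _ _).trans hx.1)).continuousAt.continuousWithinAt
  · exact fun x hx => (hG x ((le_max_left _ _).trans hx.1)).hasDerivWithinAt
  · calc G t₂ ≤ |G t₂| := le_abs_self _
      _ = |G t₂| / s₂ * s₂ := by field_simp
      _ ≤ B * s₂ := by
        gcongr
        have : 0 ≤ 4 * A * B₀ / c := by positivity
        rw [hB]; linarith
  · exact fun x hx => (hder x hx.1).continuousAt.continuousWithinAt
  · exact fun x hx => (hder x hx.1).hasDerivWithinAt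
  · intro x hx heq
    have hx0 := hspos x hx.1
    have hle := hG' x ((le_max_left _ _).trans hx.1)
    obtain ⟨hx1, hx2⟩ := ht₁ x ((le_max_right _ _).trans hx.1)
    rw [heq] at hle
    refine hle.trans_lt ?_
    set s := 1 + x * d
    have e1 : s ^ (-a) * s ^ (a - κ) = s ^ (-κ) := by rw [← Real.rpow_add hx0]; congr 1; ring
    have e2 : s ^ (a - κ - 1) = s ^ (-κ) * s ^ (a - 1) := by
      rw [← Real.rpow_add hx0]; congr 1; ring
    have hκpos : 0 < s ^ (-κ) := Real.rpow_pos_of_pos hx0 _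
    have h3 : A * B₀ ≤ c / 4 * B := by
      have : c / 4 * (4 * A * B₀ / c) = A * B₀ := by field_simp
      have h5 : 0 ≤ |G t₂| / s₂ := by positivity
      rw [← this]
      gcongr
      rw [hB]; linarith
    have key : -(c * B) + (A * s ^ (a - κ) * B + A * B₀) < -(B * ((κ - a) * d * s ^ (a - 1))) := by
      nlinarith
    calc -(c * s ^ (-a) * (B * s ^ (a - κ))) + A * s ^ (-κ) * (B * s ^ (a - κ) + B₀)
        = s ^ (-κ) * (-(c * B) + (A * s ^ (a - κ) * B + A * B₀)) := by
          rw [← e1]; ring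
      _ < s ^ (-κ) * (-(B * ((κ - a) * d * s ^ (a - 1)))) := by gcongr
      _ = _ := by rw [e2]; ring

namespace EnergyLandscape

variable {V : Type*} [Fintype V] (L : EnergyLandscape V)

/-- The chi-square excess `∑ w (m / w - 1 / Z)²` of a probability vector. -/
theorem energy_sub_eq {s : ℝ} (hs : 0 < s) {m : V → ℝ} (hm : ∑ x, m x = 1) :
    L.energy s m - 1 / L.partition s =
      ∑ x, L.weight s x * (m x / L.weight s x - 1 / L.partition s) ^ 2 := by
  have hZ := (L.partition_pos hs).ne'
  have e : ∀ x, L.weight s x * (m x / L.weight s x - 1 / L.partition s) ^ 2 =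
      m x ^ 2 / L.weight s x - 2 / L.partition s * m x + L.weight s x / L.partition s ^ 2 := by
    intro x
    have := (L.weight_pos hs x).ne'
    field_simp
    ring
  simp only [e, Finset.sum_add_distrib, Finset.sum_sub_distrib, ← Finset.mul_sum, hm,
    ← Finset.sum_div]
  rw [show ∑ x, L.weight s x = L.partition s from rfl]
  simp only [energy]
  field_simp
  ring

theorem energy_sub_nonneg {s : ℝ} (hs : 0 < s) {m : V → ℝ} (hm : ∑ x, m x = 1) :
    0 ≤ L.energy s m - 1 / L.partition s := by
  rw [L.energy_sub_eq hs hm]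
  exact Finset.sum_nonneg fun x _ => mul_nonneg (L.weight_pos hs x).le (sq_nonneg _)

/-- The Poincaré inequality for the density `m / w`, whose integral against the weights is `1`: its
variance is the chi-square excess. -/
theorem energy_sub_le {a K : ℝ} {s : ℝ} (hs : 0 < s) {m : V → ℝ} (hm : ∑ x, m x = 1)
    (hK : ∀ f : V → ℝ,
      ∑ x, L.weight s x * f x ^ 2 - (∑ x, L.weight s x * f x) ^ 2 / L.partition s ≤
        K * s ^ a * L.dirichlet s f) :
    L.energy s m - 1 / L.partition s ≤
      K * s ^ a * L.dirichlet s (fun x => m x / L.weight s x) := by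
  refine le_trans (le_of_eq ?_) (hK _)
  congr 1
  · refine Finset.sum_congr rfl fun x _ => ?_
    have := (L.weight_pos hs x).ne'
    field_simp
  · congr 1
    have : ∑ x, L.weight s x * (m x / L.weight s x) = 1 := by
      rw [← hm]
      refine Finset.sum_congr rfl fun x _ => ?_
      have := (L.weight_pos hs x).ne'
      field_simp
    rw [this, one_pow]

/-- The mass of the states of exponent at least `ρ`. -/
theorem sum_filter_le {s : ℝ} (hs : 1 ≤ s) {m : V → ℝ} (hm : ∑ x, m x = 1) (ρ : ℝ)
    (S : Finset V) (hS : ∀ x ∈ S, ρ ≤ L.θ x) :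
    ∑ x ∈ S, m x ≤ Real.sqrt (L.energy s m - 1 / L.partition s) * s ^ (-ρ / 2) +
      1 / L.mu L.ground * s ^ (-ρ) := by
  have hs0 : 0 < s := by linarith
  have hZ := L.partition_pos hs0
  have hw : ∑ x ∈ S, L.weight s x ≤ s ^ (-ρ) := by
    calc ∑ x ∈ S, L.weight s x ≤ ∑ x ∈ S, L.mu x * s ^ (-ρ) := by
          refine Finset.sum_le_sum fun x hx => ?_
          refine mul_le_mul_of_nonneg_left ?_ (L.mu_pos x).le
          exact Real.rpow_le_rpow_of_exponent_le hs (neg_le_neg (hS x hx))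
      _ = (∑ x ∈ S, L.mu x) * s ^ (-ρ) := by rw [Finset.sum_mul]
      _ ≤ 1 * s ^ (-ρ) := by
          gcongr
          exact (Finset.sum_le_univ_sum_of_nonneg fun x => (L.mu_pos x).le).trans L.mu_sum
      _ = _ := one_mul _
  have hwn : 0 ≤ ∑ x ∈ S, L.weight s x := Finset.sum_nonneg fun x _ => (L.weight_pos hs0 x).le
  -- Splitting `m = w g + w / Z`: Cauchy–Schwarz bounds the deviation `w g`, and the smallness of
  -- the weights on `S` bounds the Gibbs part.
  set g : V → ℝ := fun x => m x / L.weight s x - 1 / L.partition s with hg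
  have hsplit : ∑ x ∈ S, m x = ∑ x ∈ S, L.weight s x * g x +
      (∑ x ∈ S, L.weight s x) / L.partition s := by
    rw [Finset.sum_div, ← Finset.sum_add_distrib]
    refine Finset.sum_congr rfl fun x _ => ?_
    have := (L.weight_pos hs0 x).ne'
    rw [hg]; field_simp; ring
  have hcs : ∑ x ∈ S, L.weight s x * g x ≤
      Real.sqrt (L.energy s m - 1 / L.partition s) * s ^ (-ρ / 2) := by
    have h1 : (∑ x ∈ S, L.weight s x * g x) ^ 2 ≤
        (∑ x ∈ S, L.weight s x) * ∑ x ∈ S, L.weight s x * g x ^ 2 :=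
      Finset.sum_sq_le_sum_mul_sum_of_sq_le_mul _ (fun x _ => (L.weight_pos hs0 x).le)
        (fun x _ => mul_nonneg (L.weight_pos hs0 x).le (sq_nonneg _)) (fun x _ => le_of_eq (by ring))
    have h2 : ∑ x ∈ S, L.weight s x * g x ^ 2 ≤ L.energy s m - 1 / L.partition s := by
      rw [L.energy_sub_eq hs0 hm]
      exact Finset.sum_le_univ_sum_of_nonneg fun x =>
        mul_nonneg (L.weight_pos hs0 x).le (sq_nonneg _)
    have h3 : s ^ (-ρ / 2) = Real.sqrt (s ^ (-ρ)) := by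
      rw [Real.sqrt_eq_rpow, ← Real.rpow_mul hs0.le]; congr 1; ring
    rw [h3, ← Real.sqrt_mul (L.energy_sub_nonneg hs0 hm)]
    refine Real.le_sqrt_of_sq_le (h1.trans ?_)
    rw [mul_comm]
    exact mul_le_mul h2 hw hwn (L.energy_sub_nonneg hs0 hm)
  rw [hsplit]
  have : (∑ x ∈ S, L.weight s x) / L.partition s ≤ 1 / L.mu L.ground * s ^ (-ρ) := by
    rw [one_div, inv_mul_eq_div]
    exact div_le_div₀ (by positivity) hw (L.mu_pos _) (L.mu_ground_le_partition hs0)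
  linarith

theorem exists_θ_le : ∃ Θ : ℝ, 0 ≤ Θ ∧ ∀ x, L.θ x ≤ Θ :=
  ⟨∑ x, L.θ x, Finset.sum_nonneg fun x _ => L.θ_nonneg x,
    fun x => Finset.single_le_sum (fun y _ => L.θ_nonneg y) (Finset.mem_univ x)⟩

/-- The logarithmic derivative is `-θ d / s`: under logarithmic cooling the weights move at relative
speed `O(1 / s)`. -/
theorem hasDerivAt_weight {d t : ℝ} (ht : 0 < 1 + t * d) (x : V) :
    HasDerivAt (fun t => L.weight (1 + t * d) x)
      (-(L.θ x * d / (1 + t * d)) * L.weight (1 + t * d) x) t := by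
  have h : HasDerivAt (fun t : ℝ => 1 + t * d) d t := by
    simpa using ((hasDerivAt_id t).mul_const d).const_add 1
  have h2 := (h.rpow_const (p := -L.θ x) (Or.inl ht.ne')).const_mul (L.mu x)
  refine h2.congr_deriv ?_
  rw [weight, Real.rpow_sub_one ht.ne']
  ring

/-- The chi-square excess of a solution of the master equation. -/
theorem hasDerivAt_energy_sub {d t : ℝ} (ht : 0 < 1 + t * d) {m : ℝ → V → ℝ} {m' : V → ℝ}
    (hm : ∀ y, HasDerivAt (fun t => m t y) (m' y) t) :
    HasDerivAt (fun t => L.energy (1 + t * d) (m t) - 1 / L.partition (1 + t * d))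
      (∑ y, (2 * (m t y / L.weight (1 + t * d) y) * m' y +
          L.θ y * d / (1 + t * d) * (m t y ^ 2 / L.weight (1 + t * d) y)) -
        (∑ y, L.θ y * d / (1 + t * d) * L.weight (1 + t * d) y) / L.partition (1 + t * d) ^ 2) t := by
  have h1 : HasDerivAt (fun t => L.energy (1 + t * d) (m t))
      (∑ y, (2 * (m t y / L.weight (1 + t * d) y) * m' y +
          L.θ y * d / (1 + t * d) * (m t y ^ 2 / L.weight (1 + t * d) y))) t := by
    unfold energy
    refine HasDerivAt.fun_sum fun y _ => ?_
    have hw := (L.weight_pos ht y).ne'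
    refine (((hm y).pow 2).div (L.hasDerivAt_weight ht y) hw).congr_deriv ?_
    simp only [Pi.pow_apply]
    field_simp
    ring
  have h2 : HasDerivAt (fun t => L.partition (1 + t * d))
      (∑ y, -(L.θ y * d / (1 + t * d)) * L.weight (1 + t * d) y) t := by
    unfold partition
    exact HasDerivAt.fun_sum fun y _ => L.hasDerivAt_weight ht y
  have h3 := h2.inv (L.partition_pos ht).ne'
  simp only [one_div]
  refine (h1.sub h3).congr_deriv ?_
  congr 2
  rw [← Finset.sum_neg_distrib]
  refine Finset.sum_congr rfl fun y _ => by ring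

/-- Convergence of a perturbed annealed dynamics: the chi-square excess is `O(t ^ (a - κ))`. -/
theorem exists_energy_sub_le {a κ C d : ℝ} (hdepth : L.DepthLE a) (haκ : a < κ) (hκ : κ ≤ 1)
    (hd : 0 < d) {m : ℝ → V → ℝ} {c : ℝ → V → V → ℝ}
    (hsum : ∀ t, 0 < t → ∑ x, m t x = 1)
    (hm : ∀ t, 0 < t → ∀ y, HasDerivAt (fun t => m t y)
      (∑ x, (m t x * c t x y - m t y * c t y x)) t)
    (hc : ∀ t, 0 < t → ∀ x y, |c t x y - L.rate (1 + t * d) x y| ≤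
      C * (1 + t * d) ^ (-(κ / 2)) * L.rate (1 + t * d) x y) :
    ∃ B : ℝ, 0 < B ∧ ∀ᶠ t in atTop,
      L.energy (1 + t * d) (m t) - 1 / L.partition (1 + t * d) ≤ B * (1 + t * d) ^ (a - κ) := by
  obtain ⟨K, hK0, hK⟩ := L.exists_poincare hdepth
  obtain ⟨Θ, hΘ0, hΘ⟩ := L.exists_θ_le
  have hg := L.mu_pos L.ground
  -- The damping `1 / (2 K)` comes from the Poincaré inequality applied to the remaining half of the
  -- dissipation. In `A`, the noise gives `2 C ^ 2` and the cooling `Θ d`; `B₀` bounds `1 / Z`, the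
  -- gap between the energy and its excess. Any positive starting time would do.
  refine exists_le_rpow_of_deriv_le (t₀ := 1) (c := 1 / (2 * K)) (A := 2 * C ^ 2 + Θ * d)
    (B₀ := 1 / L.mu L.ground) hd (by positivity) (by positivity) (by positivity) haκ hκ zero_le_one
    (fun t ht => L.hasDerivAt_energy_sub (by have := mul_pos (zero_lt_one.trans_le ht) hd; linarith)
      (hm t (by linarith))) (fun t ht => ?_)
  have ht0 : 0 < t := by linarith
  have hs1 : 1 ≤ 1 + t * d := by have := mul_pos ht0 hd; linarith
  have hdis := L.sum_master_le hs1 (m t) (c t) (hc t ht0)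
  set s := 1 + t * d with hs
  have hs0 : 0 < s := by linarith
  have hpo := L.energy_sub_le hs0 (hsum t ht0) (hK s hs1)
  have hZ := L.partition_pos hs0
  set D := L.dirichlet s (fun x => m t x / L.weight s x)
  set G := L.energy s (m t) - 1 / L.partition s with hG
  have hG0 : 0 ≤ G := L.energy_sub_nonneg hs0 (hsum t ht0)
  have hF : L.energy s (m t) ≤ G + 1 / L.mu L.ground := by
    have : 1 / L.partition s ≤ 1 / L.mu L.ground :=
      one_div_le_one_div_of_le hg (L.mu_ground_le_partition hs0)
    rw [hG]; linarith
  have hF0 : 0 ≤ L.energy s (m t) :=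
    Finset.sum_nonneg fun x _ => div_nonneg (sq_nonneg _) (L.weight_pos hs0 x).le
  -- Cooling decreases the partition function, so the derivative of `-1 / Z` has the favourable sign
  -- and is discarded.
  have hdrop : 0 ≤ (∑ y, L.θ y * d / s * L.weight s y) / L.partition s ^ 2 := by
    refine div_nonneg (Finset.sum_nonneg fun y _ => ?_) (sq_nonneg _)
    have := L.θ_nonneg y
    have := L.weight_pos hs0 y
    positivity
  have hθ : ∑ y, L.θ y * d / s * (m t y ^ 2 / L.weight s y) ≤ Θ * d / s * L.energy s (m t) := by
    rw [energy, Finset.mul_sum]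
    refine Finset.sum_le_sum fun y _ => ?_
    have := L.weight_pos hs0 y
    have := hΘ y
    gcongr
  have hDG : 1 / (2 * K) * s ^ (-a) * G ≤ D / 2 := by
    have e : s ^ (-a) * s ^ a = 1 := by rw [← Real.rpow_add hs0]; simp
    calc 1 / (2 * K) * s ^ (-a) * G ≤ 1 / (2 * K) * s ^ (-a) * (K * s ^ a * D) := by gcongr
      _ = (s ^ (-a) * s ^ a) * D / 2 := by field_simp
      _ = D / 2 := by rw [e, one_mul]
  -- Here `κ ≤ 1` is used: the cooling term of order `1 / s` is absorbed at the common order `s ^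
  -- (-κ)`.
  have hsκ : 1 / s ≤ s ^ (-κ) := by
    rw [one_div, ← Real.rpow_neg_one]
    exact Real.rpow_le_rpow_of_exponent_le hs1 (by linarith)
  have hδ : (C * s ^ (-(κ / 2))) ^ 2 = C ^ 2 * s ^ (-κ) := by
    rw [mul_pow, ← Real.rpow_natCast (s ^ _), ← Real.rpow_mul hs0.le]
    congr 2; push_cast; ring
  rw [hδ] at hdis
  rw [Finset.sum_add_distrib]
  have hA : (2 * (C ^ 2 * s ^ (-κ)) + Θ * d / s) * L.energy s (m t) ≤
      (2 * C ^ 2 + Θ * d) * s ^ (-κ) * (G + 1 / L.mu L.ground) := by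
    refine mul_le_mul ?_ hF hF0 (by positivity)
    have : Θ * d * (1 / s) ≤ Θ * d * s ^ (-κ) := by gcongr
    rw [mul_one_div] at this
    linarith
  linarith

end EnergyLandscape

/-! ### Jump chains and their occupation probabilities -/

/-- The density at `τ` of a unit exponential waiting time started at `s`. -/
noncomputable def waitDensity (s τ : ℝ) : ℝ≥0∞ :=
  if s ≤ τ then ENNReal.ofReal (Real.exp (-(τ - s))) else 0

theorem measurable_waitDensity : Measurable fun p : ℝ × ℝ => waitDensity p.1 p.2 := by
  unfold waitDensity
  exact Measurable.ite (measurableSet_le measurable_fst measurable_snd) (by fun_prop)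
    measurable_const

theorem lintegral_exp_neg_Ici (s v : ℝ) :
    ∫⁻ τ in Set.Ici v, ENNReal.ofReal (Real.exp (-(τ - s))) =
      ENNReal.ofReal (Real.exp (-(v - s))) := by
  have e : ∀ τ, Real.exp (-(τ - s)) = Real.exp s * Real.exp (-τ) := fun τ => by
    rw [← Real.exp_add]; congr 1; ring
  simp only [e]
  rw [setLIntegral_congr Ioi_ae_eq_Ici.symm, ← ofReal_integral_eq_lintegral_ofReal
    ((integrableOn_exp_neg_Ioi v).const_mul _) (ae_of_all _ fun τ => by positivity),
    integral_const_mul, integral_exp_neg_Ioi]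

theorem lintegral_waitDensity (u s : ℝ) :
    ∫⁻ τ in Set.Ici u, waitDensity s τ = ENNReal.ofReal (Real.exp (-(max u s - s))) := by
  have e : (fun τ => waitDensity s τ) =
      (Set.Ici s).indicator fun τ => ENNReal.ofReal (Real.exp (-(τ - s))) := by
    ext τ; simp [waitDensity, Set.indicator, Set.mem_Ici]
  rw [e, setLIntegral_indicator measurableSet_Ici, Set.Ici_inter_Ici, sup_comm,
    lintegral_exp_neg_Ici]

/-- `(χ_k, T_k)` is a Markov chain of jump locations and unit rate exponential jump times, with
location law `q τ x ·` for a jump from `x` at time `τ`. -/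
structure IsJumpChain {E Ξ : Type*} [Fintype E] [MeasurableSpace E] [MeasurableSpace Ξ]
    (ℙ : Measure Ξ) (χ : ℕ → Ξ → E) (T : ℕ → Ξ → ℝ) (q : ℝ → E → E → ℝ≥0∞) : Prop where
  measurable_state : ∀ k, Measurable (χ k)
  measurable_time : ∀ k, Measurable (T k)
  time_zero : ∀ᵐ ξ ∂ℙ, T 0 ξ = 0
  measurable_rate : ∀ x y, Measurable fun τ => q τ x y
  rate_sum : ∀ τ, 0 ≤ τ → ∀ x, ∑ y, q τ x y = 1
  step : ∀ (k : ℕ) (x y : E) (A : Set ℝ) (u : ℝ), MeasurableSet A → 0 ≤ u →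
    ℙ {ξ | (χ k ξ = x ∧ T k ξ ∈ A) ∧ χ (k + 1) ξ = y ∧ u ≤ T (k + 1) ξ} =
      ∫⁻ ξ in {ξ | χ k ξ = x ∧ T k ξ ∈ A},
        (∫⁻ τ in Set.Ici u, q τ x y * waitDensity (T k ξ) τ) ∂ℙ

set_option linter.unusedSectionVars false

namespace IsJumpChain

variable {E Ξ : Type*} [Fintype E] [MeasurableSpace E] [MeasurableSingletonClass E]
  [MeasurableSpace Ξ] {ℙ : Measure Ξ} [IsProbabilityMeasure ℙ] {χ : ℕ → Ξ → E} {T : ℕ → Ξ → ℝ}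
  {q : ℝ → E → E → ℝ≥0∞}

/-- The probability that the `k`-th location is `x` and is occupied at time `t`. -/
noncomputable def occupation (ℙ : Measure Ξ) (χ : ℕ → Ξ → E) (T : ℕ → Ξ → ℝ) (k : ℕ) (t : ℝ)
    (x : E) : ℝ≥0∞ := ∫⁻ ξ in {ξ | χ k ξ = x}, waitDensity (T k ξ) t ∂ℙ

theorem measurableSet_state (h : IsJumpChain ℙ χ T q) (k : ℕ) (x : E) :
    MeasurableSet {ξ | χ k ξ = x} :=
  h.measurable_state k (measurableSet_singleton x)

theorem measurable_occupation (h : IsJumpChain ℙ χ T q) (k : ℕ) (x : E) :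
    Measurable fun t => occupation ℙ χ T k t x := by
  have := measurable_waitDensity
  have hT := h.measurable_time k
  unfold occupation
  exact Measurable.lintegral_prod_right' (f := fun p : ℝ × Ξ => waitDensity (T k p.2) p.1)
    (this.comp ((hT.comp measurable_snd).prodMk measurable_fst))

theorem measurable_waitDensity_right (s : ℝ) : Measurable (waitDensity s) :=
  measurable_waitDensity.comp (measurable_const.prodMk measurable_id)

theorem measurable_waitDensity_left (t : ℝ) : Measurable fun s => waitDensity s t :=
  measurable_waitDensity.comp (measurable_id.prodMk measurable_const)

theorem measure_eq_sum_state (h : IsJumpChain ℙ χ T q) (k : ℕ) (B : Set Ξ) :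
    ℙ B = ∑ y, ℙ {ξ | ξ ∈ B ∧ χ k ξ = y} := by
  have hs := sum_measure_preimage_singleton (μ := ℙ.restrict B) (f := χ k) Finset.univ
    (fun y _ => h.measurable_state k (measurableSet_singleton y))
  rw [Finset.coe_univ, Set.preimage_univ, Measure.restrict_apply_univ] at hs
  rw [← hs]
  refine Finset.sum_congr rfl fun y _ => ?_
  rw [Measure.restrict_apply (h.measurable_state k (measurableSet_singleton y))]
  congr 1
  ext ξ
  simp [and_comm]

theorem measurable_inner (h : IsJumpChain ℙ χ T q) (k : ℕ) (x y : E) :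
    Measurable fun p : Ξ × ℝ => q p.2 x y * waitDensity (T k p.1) p.2 :=
  ((h.measurable_rate x y).comp measurable_snd).mul (measurable_waitDensity.comp
    (((h.measurable_time k).comp measurable_fst).prodMk measurable_snd))

/-- Summing out the next location leaves the survival probability of the exponential waiting time.
-/
theorem step_sum (h : IsJumpChain ℙ χ T q) (k : ℕ) (x : E) {A : Set ℝ} {u : ℝ}
    (hA : MeasurableSet A) (hu : 0 ≤ u) :
    ℙ {ξ | (χ k ξ = x ∧ T k ξ ∈ A) ∧ u ≤ T (k + 1) ξ} =
      ∫⁻ ξ in {ξ | χ k ξ = x ∧ T k ξ ∈ A},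
        ENNReal.ofReal (Real.exp (-(max u (T k ξ) - T k ξ))) ∂ℙ := by
  rw [h.measure_eq_sum_state (k + 1)]
  calc _ = ∑ y, ∫⁻ ξ in {ξ | χ k ξ = x ∧ T k ξ ∈ A},
        (∫⁻ τ in Set.Ici u, q τ x y * waitDensity (T k ξ) τ) ∂ℙ := by
        refine Finset.sum_congr rfl fun y _ => ?_
        rw [← h.step k x y A u hA hu]
        congr 1
        ext ξ
        simp only [Set.mem_ofPred_eq]
        tauto
    _ = _ := by
        rw [← lintegral_finsetSum _ fun y _ => (h.measurable_inner k x y).lintegral_prod_right']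
        refine lintegral_congr fun ξ => ?_
        have hy : ∀ y, Measurable fun τ => q τ x y * waitDensity (T k ξ) τ := fun y =>
          (h.measurable_rate x y).mul (measurable_waitDensity_right _)
        rw [← lintegral_waitDensity]
        simp only
        rw [← lintegral_finsetSum _ fun y _ => hy y]
        refine setLIntegral_congr_fun measurableSet_Ici fun τ hτ => ?_
        rw [← Finset.sum_mul, h.rate_sum τ (hu.trans hτ), one_mul]

/-- When `T k ≥ u` the survival probability up to `u` equals `1`, so requiring `T (k + 1) ≥ u` as
well does not change the measure of the event. -/
theorem ae_le_time_succ (h : IsJumpChain ℙ χ T q) (k : ℕ) {u : ℝ} (hu : 0 ≤ u) :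
    ∀ᵐ ξ ∂ℙ, u ≤ T k ξ → u ≤ T (k + 1) ξ := by
  have hT := h.measurable_time
  have key : ∀ x, ∀ᵐ ξ ∂ℙ, χ k ξ = x → u ≤ T k ξ → u ≤ T (k + 1) ξ := by
    intro x
    have hS : MeasurableSet {ξ | χ k ξ = x ∧ T k ξ ∈ Set.Ici u} :=
      (h.measurableSet_state k x).inter (hT k measurableSet_Ici)
    have h1 := h.step_sum k x (A := Set.Ici u) measurableSet_Ici hu
    have h2 : ∫⁻ ξ in {ξ | χ k ξ = x ∧ T k ξ ∈ Set.Ici u},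
        ENNReal.ofReal (Real.exp (-(max u (T k ξ) - T k ξ))) ∂ℙ =
        ℙ {ξ | χ k ξ = x ∧ T k ξ ∈ Set.Ici u} := by
      rw [← setLIntegral_one]
      refine setLIntegral_congr_fun hS fun ξ hξ => ?_
      rw [max_eq_right hξ.2]
      simp
    rw [h2] at h1
    have h3 : ({ξ | (χ k ξ = x ∧ T k ξ ∈ Set.Ici u) ∧ u ≤ T (k + 1) ξ} : Set Ξ) =ᵐ[ℙ]
        {ξ | χ k ξ = x ∧ T k ξ ∈ Set.Ici u} :=
      ae_eq_of_subset_of_measure_ge (fun ξ hξ => hξ.1) h1.ge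
        (hS.inter (hT (k + 1) measurableSet_Ici)).nullMeasurableSet (measure_ne_top _ _)
    filter_upwards [h3] with ξ hξ hx hk
    exact (hξ.mpr ⟨hx, hk⟩).2
  filter_upwards [ae_all_iff.2 key] with ξ hξ using hξ _ rfl

theorem ae_time_nonneg (h : IsJumpChain ℙ χ T q) (k : ℕ) : ∀ᵐ ξ ∂ℙ, 0 ≤ T k ξ := by
  induction k with
  | zero => filter_upwards [h.time_zero] with ξ hξ using hξ.ge
  | succ k ih => filter_upwards [ih, h.ae_le_time_succ k le_rfl] with ξ h1 h2 using h2 h1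

theorem ae_time_monotone (h : IsJumpChain ℙ χ T q) : ∀ᵐ ξ ∂ℙ, Monotone fun k => T k ξ := by
  -- Rational levels give a single null set and still separate any two times in the wrong order.
  have h1 : ∀ᵐ ξ ∂ℙ, ∀ (k : ℕ) (u : ℚ), (0 : ℝ) ≤ u → (u : ℝ) ≤ T k ξ → (u : ℝ) ≤ T (k + 1) ξ := by
    refine ae_all_iff.2 fun k => ae_all_iff.2 fun u => ?_
    by_cases hu : (0 : ℝ) ≤ u
    · filter_upwards [h.ae_le_time_succ k hu] with ξ hξ _ using hξ
    · exact ae_of_all _ fun ξ hu' => absurd hu' hu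
  filter_upwards [h1, ae_all_iff.2 h.ae_time_nonneg] with ξ hξ h0
  refine monotone_nat_of_le_succ fun k => ?_
  by_contra hlt
  obtain ⟨u, hu1, hu2⟩ := exists_rat_btwn (not_le.1 hlt)
  exact absurd (hξ k u ((h0 (k + 1)).trans hu1.le) hu2.le) (not_le.2 hu1)

theorem measurable_occupation_mul (h : IsJumpChain ℙ χ T q) (k : ℕ) (x y : E) :
    Measurable fun τ => occupation ℙ χ T k τ x * q τ x y :=
  (h.measurable_occupation k x).mul (h.measurable_rate x y)

/-- The joint law of the next location and the next jump time. -/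
theorem lintegral_time_succ (h : IsJumpChain ℙ χ T q) (k : ℕ) (y : E) {g : ℝ → ℝ≥0∞}
    (hg : Measurable g) :
    ∫⁻ ξ in {ξ | χ (k + 1) ξ = y}, g (T (k + 1) ξ) ∂ℙ =
      ∫⁻ τ in Set.Ici 0, g τ * ∑ x, occupation ℙ χ T k τ x * q τ x y := by
  have hT := h.measurable_time
  have hr : Measurable fun τ => ∑ x, occupation ℙ χ T k τ x * q τ x y :=
    Finset.measurable_fun_sum _ fun x _ => h.measurable_occupation_mul k x y
  have hmeas : (ℙ.restrict {ξ | χ (k + 1) ξ = y}).map (T (k + 1)) =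
      (volume.restrict (Set.Ici 0)).withDensity
        fun τ => ∑ x, occupation ℙ χ T k τ x * q τ x y := by
    refine Measure.ext_of_Ici _ _ fun u => ?_
    rw [Measure.map_apply (hT _) measurableSet_Ici, withDensity_apply _ measurableSet_Ici,
      Measure.restrict_restrict measurableSet_Ici, Set.Ici_inter_Ici,
      Measure.restrict_apply (hT _ measurableSet_Ici)]
    -- Jump times are almost surely nonnegative, so the level may be raised to `max u 0`, where the
    -- step law is available.
    have e1 : ℙ (T (k + 1) ⁻¹' Set.Ici u ∩ {ξ | χ (k + 1) ξ = y}) =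
        ℙ {ξ | χ (k + 1) ξ = y ∧ max u 0 ≤ T (k + 1) ξ} := by
      refine measure_congr ?_
      filter_upwards [h.ae_time_nonneg (k + 1)] with ξ hξ
      refine propext ?_
      change (u ≤ T (k + 1) ξ ∧ χ (k + 1) ξ = y) ↔ (χ (k + 1) ξ = y ∧ max u 0 ≤ T (k + 1) ξ)
      simp [hξ, and_comm]
    change _ = ∫⁻ τ in Set.Ici (max u 0), _
    rw [e1]
    set v := max u 0 with hv
    have hv0 : 0 ≤ v := le_max_right _ _
    rw [h.measure_eq_sum_state k, lintegral_finsetSum _ fun x _ =>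
      h.measurable_occupation_mul k x y]
    refine Finset.sum_congr rfl fun x _ => ?_
    have hst := h.step k x y Set.univ v MeasurableSet.univ hv0
    simp only [Set.mem_univ, and_true] at hst
    have e2 : ({ξ | ξ ∈ {ξ | χ (k + 1) ξ = y ∧ v ≤ T (k + 1) ξ} ∧ χ k ξ = x} : Set Ξ) =
        {ξ | χ k ξ = x ∧ χ (k + 1) ξ = y ∧ v ≤ T (k + 1) ξ} := by
      ext ξ; simp only [Set.mem_ofPred_eq]; tauto
    rw [e2, hst, lintegral_lintegral_swap (h.measurable_inner k x y).aemeasurable]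
    refine lintegral_congr fun τ => ?_
    have hw : Measurable fun ξ => waitDensity (T k ξ) τ :=
      (measurable_waitDensity_left τ).comp (hT k)
    rw [lintegral_const_mul _ hw, mul_comm]
    rfl
  rw [← lintegral_map hg (hT (k + 1)), hmeas, lintegral_withDensity_eq_lintegral_mul _ hr hg]
  refine lintegral_congr fun τ => ?_
  rw [Pi.mul_apply, mul_comm]

theorem occupation_zero (h : IsJumpChain ℙ χ T q) (t : ℝ) (x : E) :
    occupation ℙ χ T 0 t x = waitDensity 0 t * ℙ {ξ | χ 0 ξ = x} := by
  unfold occupation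
  rw [← setLIntegral_const]
  refine lintegral_congr_ae (ae_restrict_of_ae ?_)
  filter_upwards [h.time_zero] with ξ hξ
  rw [hξ]

theorem occupation_succ (h : IsJumpChain ℙ χ T q) (k : ℕ) (t : ℝ) (y : E) :
    occupation ℙ χ T (k + 1) t y =
      ∫⁻ τ in Set.Ici 0, waitDensity τ t * ∑ x, occupation ℙ χ T k τ x * q τ x y :=
  h.lintegral_time_succ k y (measurable_waitDensity_left t)

/-- Induction over the jumps: a set that no jump leaves carries every location of the chain. -/
theorem occupation_eq_zero (h : IsJumpChain ℙ χ T q) {A : Set E}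
    (h0 : ∀ᵐ ξ ∂ℙ, χ 0 ξ ∈ A) (hA : ∀ τ, 0 ≤ τ → ∀ x ∈ A, ∀ y ∉ A, q τ x y = 0) (k : ℕ) (t : ℝ)
    {y : E} (hy : y ∉ A) : occupation ℙ χ T k t y = 0 := by
  induction k generalizing t y with
  | zero =>
    rw [h.occupation_zero]
    have : ℙ {ξ | χ 0 ξ = y} = 0 := by
      refine measure_mono_null ?_ h0
      intro ξ hξ hmem
      rw [Set.mem_ofPred_eq] at hξ
      exact hy (hξ ▸ hmem)
    rw [this, mul_zero]
  | succ k ih =>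
    rw [h.occupation_succ]
    refine (setLIntegral_congr_fun measurableSet_Ici fun τ hτ => ?_).trans lintegral_zero
    rw [Finset.sum_eq_zero, mul_zero]
    intro x _
    by_cases hx : x ∈ A
    · rw [hA τ hτ x hx y hy, mul_zero]
    · rw [ih τ hx, zero_mul]

/-- Each later jump time has a density. The index is shifted because `T 0` is an atom at `0`. -/
theorem measure_time_eq (h : IsJumpChain ℙ χ T q) (k : ℕ) (t : ℝ) :
    ℙ {ξ | T (k + 1) ξ = t} = 0 := by
  rw [h.measure_eq_sum_state (k + 1)]
  refine Finset.sum_eq_zero fun y _ => ?_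
  have h1 := h.lintegral_time_succ k y (g := Set.indicator {t} 1)
    (measurable_one.indicator (measurableSet_singleton t))
  have h2 : ∫⁻ ξ in {ξ | χ (k + 1) ξ = y}, Set.indicator {t} 1 (T (k + 1) ξ) ∂ℙ =
      ℙ {ξ | ξ ∈ {ξ | T (k + 1) ξ = t} ∧ χ (k + 1) ξ = y} := by
    have e : (fun ξ => Set.indicator {t} (1 : ℝ → ℝ≥0∞) (T (k + 1) ξ)) =
        (T (k + 1) ⁻¹' {t}).indicator 1 := by
      ext ξ; simp [Set.indicator]
    rw [e, lintegral_indicator_one (h.measurable_time _ (measurableSet_singleton t)),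
      Measure.restrict_apply (h.measurable_time _ (measurableSet_singleton t))]
    rfl
  rw [← h2, h1]
  refine (lintegral_congr_ae (ae_restrict_of_ae ?_)).trans lintegral_zero
  have : ∀ᵐ τ : ℝ, τ ≠ t := by simp [ae_iff]
  filter_upwards [this] with τ hτ
  simp [hτ]

/-- The unit exponential law has its density equal to its survival function, so `waitDensity (T k)
t` is also the conditional probability that the `k`-th sojourn, once begun, lasts beyond `t`. Strict
and weak inequalities agree since `T (k + 1)` has no atoms. -/
theorem occupation_eq (h : IsJumpChain ℙ χ T q) (k : ℕ) {t : ℝ} (ht : 0 ≤ t) (x : E) :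
    occupation ℙ χ T k t x = ℙ {ξ | ξ ∈ {ξ | T k ξ ≤ t ∧ t < T (k + 1) ξ} ∧ χ k ξ = x} := by
  have hT := h.measurable_time
  have h1 := h.step_sum k x (A := Set.Iic t) measurableSet_Iic ht
  have e : ℙ {ξ | ξ ∈ {ξ | T k ξ ≤ t ∧ t < T (k + 1) ξ} ∧ χ k ξ = x} =
      ℙ {ξ | (χ k ξ = x ∧ T k ξ ∈ Set.Iic t) ∧ t ≤ T (k + 1) ξ} := by
    refine measure_congr ?_
    have h2 : ∀ᵐ ξ ∂ℙ, T (k + 1) ξ ≠ t := by simpa [ae_iff] using h.measure_time_eq k t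
    filter_upwards [h2] with ξ hξ
    refine propext ?_
    change ((T k ξ ≤ t ∧ t < T (k + 1) ξ) ∧ χ k ξ = x) ↔
      ((χ k ξ = x ∧ T k ξ ≤ t) ∧ t ≤ T (k + 1) ξ)
    rw [lt_iff_le_and_ne]
    have := hξ.symm
    tauto
  rw [e, h1, occupation]
  have hS : MeasurableSet {ξ | T k ξ ∈ Set.Iic t} := hT k measurableSet_Iic
  have e2 : ({ξ | χ k ξ = x ∧ T k ξ ∈ Set.Iic t} : Set Ξ) =
    {ξ | T k ξ ∈ Set.Iic t} ∩ {ξ | χ k ξ = x} := by ext ξ; simp [and_comm]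
  rw [e2, ← Measure.restrict_restrict hS, ← lintegral_indicator hS]
  refine lintegral_congr fun ξ => ?_
  by_cases hξ : T k ξ ≤ t
  · rw [Set.indicator_of_mem (by exact hξ), waitDensity, if_pos hξ, max_eq_left hξ]
  · rw [Set.indicator_of_notMem (by exact hξ), waitDensity, if_neg hξ]

/-- The probability of being at `x` at time `t`. -/
noncomputable def mass (ℙ : Measure Ξ) (χ : ℕ → Ξ → E) (T : ℕ → Ξ → ℝ) (t : ℝ) (x : E) : ℝ≥0∞ :=
  ∑' k, occupation ℙ χ T k t x

theorem measurable_mass (h : IsJumpChain ℙ χ T q) (x : E) :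
    Measurable fun t => mass ℙ χ T t x :=
  Measurable.tsum fun k => h.measurable_occupation k x

/-- Monotone jump times make the sojourn intervals disjoint. A deficit from `1` would be the
probability of explosion before `t`. -/
theorem sum_mass (h : IsJumpChain ℙ χ T q) {t : ℝ} (ht : 0 ≤ t) :
    ∑ x, mass ℙ χ T t x = ℙ (⋃ k, {ξ | T k ξ ≤ t ∧ t < T (k + 1) ξ}) := by
  have hT := h.measurable_time
  unfold mass
  rw [← Summable.tsum_finsetSum fun x _ => ENNReal.summable, measure_iUnion₀]
  · refine tsum_congr fun k => ?_
    rw [h.measure_eq_sum_state k]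
    exact Finset.sum_congr rfl fun x _ => h.occupation_eq k ht x
  · have key : ∀ i j, i < j → AEDisjoint ℙ {ξ | T i ξ ≤ t ∧ t < T (i + 1) ξ}
        {ξ | T j ξ ≤ t ∧ t < T (j + 1) ξ} := by
      intro i j hij
      refine measure_mono_null ?_ h.ae_time_monotone
      rintro ξ ⟨h1, h2⟩ hm
      exact absurd ((hm (Nat.succ_le_of_lt hij)).trans h2.1) (not_le.2 h1.2)
    intro i j hij
    rcases lt_or_gt_of_ne hij with h1 | h1
    · exact key i j h1
    · exact (key j i h1).symm
  · exact fun k => ((measurableSet_le (hT k) measurable_const).inter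
      (measurableSet_lt measurable_const (hT (k + 1)))).nullMeasurableSet

/-- Decomposition at the last jump before `t`: either none has occurred, or the last one arrived at
`y` at time `τ` and `waitDensity τ t` is the probability of no jump since. -/
theorem mass_eq (h : IsJumpChain ℙ χ T q) (t : ℝ) (y : E) :
    mass ℙ χ T t y = waitDensity 0 t * ℙ {ξ | χ 0 ξ = y} +
      ∫⁻ τ in Set.Ici 0, waitDensity τ t * ∑ x, mass ℙ χ T τ x * q τ x y := by
  rw [mass, tsum_eq_zero_add' ENNReal.summable, h.occupation_zero]
  congr 1
  simp only [h.occupation_succ]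
  have hm : ∀ k, Measurable fun τ => waitDensity τ t * ∑ x, occupation ℙ χ T k τ x * q τ x y :=
    fun k => (measurable_waitDensity_left t).mul
      (Finset.measurable_fun_sum _ fun x _ => h.measurable_occupation_mul k x y)
  rw [← lintegral_tsum fun k => (hm k).aemeasurable]
  refine lintegral_congr fun τ => ?_
  rw [ENNReal.tsum_mul_left, Summable.tsum_finsetSum fun x _ => ENNReal.summable]
  congr 1
  refine Finset.sum_congr rfl fun x _ => ?_
  rw [ENNReal.tsum_mul_right, mass]

end IsJumpChain

/-! ### Forward equation and conservation of mass -/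

namespace IsJumpChain

variable {E Ξ : Type*} [Fintype E] [MeasurableSpace E] [MeasurableSingletonClass E]
  [MeasurableSpace Ξ] {ℙ : Measure Ξ} [IsProbabilityMeasure ℙ] {χ : ℕ → Ξ → E} {T : ℕ → Ξ → ℝ}
  {q : ℝ → E → E → ℝ≥0∞}

theorem sum_mass_le_one (h : IsJumpChain ℙ χ T q) {t : ℝ} (ht : 0 ≤ t) :
    ∑ x, mass ℙ χ T t x ≤ 1 := by
  rw [h.sum_mass ht]; exact prob_le_one

theorem mass_le_one (h : IsJumpChain ℙ χ T q) {t : ℝ} (ht : 0 ≤ t) (x : E) :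
    mass ℙ χ T t x ≤ 1 :=
  (Finset.single_le_sum (f := fun x => mass ℙ χ T t x) (fun _ _ => zero_le)
    (Finset.mem_univ x)).trans (h.sum_mass_le_one ht)

theorem rate_le_one (h : IsJumpChain ℙ χ T q) {t : ℝ} (ht : 0 ≤ t) (x y : E) : q t x y ≤ 1 :=
  (Finset.single_le_sum (f := fun y => q t x y) (fun _ _ => zero_le)
    (Finset.mem_univ y)).trans (h.rate_sum t ht x).le

/-- The rate of arrival at `y` at time `τ`. -/
noncomputable def influx (ℙ : Measure Ξ) (χ : ℕ → Ξ → E) (T : ℕ → Ξ → ℝ) (q : ℝ → E → E → ℝ≥0∞)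
    (y : E) (τ : ℝ) : ℝ := ∑ x, (mass ℙ χ T τ x).toReal * (q τ x y).toReal

theorem measurable_influx (h : IsJumpChain ℙ χ T q) (y : E) : Measurable (influx ℙ χ T q y) :=
  Finset.measurable_fun_sum _ fun x _ =>
    (h.measurable_mass x).ennreal_toReal.mul (h.measurable_rate x y).ennreal_toReal

theorem influx_nonneg (y : E) (τ : ℝ) : 0 ≤ influx ℙ χ T q y τ :=
  Finset.sum_nonneg fun _ _ => mul_nonneg ENNReal.toReal_nonneg ENNReal.toReal_nonneg

theorem ofReal_influx (h : IsJumpChain ℙ χ T q) (y : E) {τ : ℝ} (hτ : 0 ≤ τ) :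
    ENNReal.ofReal (influx ℙ χ T q y τ) = ∑ x, mass ℙ χ T τ x * q τ x y := by
  rw [influx, ENNReal.ofReal_sum_of_nonneg fun _ _ =>
    mul_nonneg ENNReal.toReal_nonneg ENNReal.toReal_nonneg]
  refine Finset.sum_congr rfl fun x _ => ?_
  rw [ENNReal.ofReal_mul ENNReal.toReal_nonneg, ENNReal.ofReal_toReal, ENNReal.ofReal_toReal]
  · exact ne_top_of_le_ne_top ENNReal.one_ne_top (h.rate_le_one hτ x y)
  · exact ne_top_of_le_ne_top ENNReal.one_ne_top (h.mass_le_one hτ x)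

theorem influx_le (h : IsJumpChain ℙ χ T q) (y : E) {τ : ℝ} (hτ : 0 ≤ τ) :
    influx ℙ χ T q y τ ≤ 1 := by
  rw [← ENNReal.ofReal_le_one, h.ofReal_influx y hτ]
  refine le_trans (Finset.sum_le_sum fun x _ => ?_) (h.sum_mass_le_one hτ)
  exact mul_le_of_le_one_right zero_le (h.rate_le_one hτ x y)

/-- The influx, extended by `0` to negative times and weighted by `exp`. -/
noncomputable def expInflux (ℙ : Measure Ξ) (χ : ℕ → Ξ → E) (T : ℕ → Ξ → ℝ)
    (q : ℝ → E → E → ℝ≥0∞) (y : E) (τ : ℝ) : ℝ :=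
  (Set.Ici 0).indicator (fun τ => Real.exp τ * influx ℙ χ T q y τ) τ

theorem measurable_expInflux (h : IsJumpChain ℙ χ T q) (y : E) :
    Measurable (expInflux ℙ χ T q y) :=
  (Real.measurable_exp.mul (h.measurable_influx y)).indicator measurableSet_Ici

theorem expInflux_nonneg (y : E) (τ : ℝ) : 0 ≤ expInflux ℙ χ T q y τ :=
  Set.indicator_nonneg (fun _ _ => mul_nonneg (Real.exp_nonneg _) (influx_nonneg _ _)) τ

theorem expInflux_le (h : IsJumpChain ℙ χ T q) (y : E) (τ : ℝ) :
    expInflux ℙ χ T q y τ ≤ Real.exp τ := by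
  unfold expInflux
  by_cases hτ : τ ∈ Set.Ici (0 : ℝ)
  · rw [Set.indicator_of_mem hτ]
    exact mul_le_of_le_one_right (Real.exp_nonneg _) (h.influx_le y hτ)
  · rw [Set.indicator_of_notMem hτ]
    exact Real.exp_nonneg _

theorem intervalIntegrable_expInflux (h : IsJumpChain ℙ χ T q) (y : E) (a b : ℝ) :
    IntervalIntegrable (expInflux ℙ χ T q y) volume a b :=
  (Real.continuous_exp.intervalIntegrable a b).mono_fun'
    (h.measurable_expInflux y).aestronglyMeasurable
    (ae_of_all _ fun τ => by
      beta_reduce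
      rw [Real.norm_eq_abs, abs_of_nonneg (expInflux_nonneg y τ)]; exact h.expInflux_le y τ)

/-- Duhamel's formula for the law at time `t`. -/
theorem toReal_mass (h : IsJumpChain ℙ χ T q) {t : ℝ} (ht : 0 ≤ t) (y : E) :
    (mass ℙ χ T t y).toReal = Real.exp (-t) * (ℙ.real {ξ | χ 0 ξ = y} +
      ∫ τ in (0)..t, expInflux ℙ χ T q y τ) := by
  have hint : IntegrableOn (expInflux ℙ χ T q y) (Set.Ioc 0 t) :=
    (intervalIntegrable_iff_integrableOn_Ioc_of_le ht).1 (h.intervalIntegrable_expInflux y 0 t)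
  have e1 : ∫⁻ τ in Set.Ici 0, waitDensity τ t * ∑ x, mass ℙ χ T τ x * q τ x y =
      ENNReal.ofReal (Real.exp (-t) * ∫ τ in (0)..t, expInflux ℙ χ T q y τ) := by
    rw [intervalIntegral.integral_of_le ht, ENNReal.ofReal_mul (Real.exp_nonneg _),
      ofReal_integral_eq_lintegral_ofReal hint (ae_of_all _ fun τ => expInflux_nonneg y τ),
      ← lintegral_const_mul _ (h.measurable_expInflux y).ennreal_ofReal,
      setLIntegral_congr Ioc_ae_eq_Icc, ← lintegral_indicator measurableSet_Ici,
      ← lintegral_indicator measurableSet_Icc]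
    refine lintegral_congr fun τ => ?_
    by_cases h0 : 0 ≤ τ
    · rw [Set.indicator_of_mem (by exact h0)]
      by_cases h1 : τ ≤ t
      · rw [Set.indicator_of_mem (by exact ⟨h0, h1⟩), waitDensity, if_pos h1, expInflux,
          Set.indicator_of_mem (by exact h0), ENNReal.ofReal_mul (Real.exp_nonneg _), ← mul_assoc,
          ← ENNReal.ofReal_mul (Real.exp_nonneg _), ← Real.exp_add, h.ofReal_influx y h0]
        congr 3
        ring
      · rw [Set.indicator_of_notMem (fun hm => h1 hm.2), waitDensity, if_neg h1, zero_mul]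
    · rw [Set.indicator_of_notMem (by exact h0), Set.indicator_of_notMem (fun hm => h0 hm.1)]
  have hI : 0 ≤ ∫ τ in (0)..t, expInflux ℙ χ T q y τ :=
    intervalIntegral.integral_nonneg ht fun τ _ => expInflux_nonneg y τ
  rw [h.mass_eq, e1, waitDensity, if_pos ht, sub_zero, ENNReal.toReal_add
    (ENNReal.mul_ne_top ENNReal.ofReal_ne_top (measure_ne_top _ _)) ENNReal.ofReal_ne_top,
    ENNReal.toReal_mul, ENNReal.toReal_ofReal (Real.exp_nonneg _),
    ENNReal.toReal_ofReal (mul_nonneg (Real.exp_nonneg _) hI), mul_add]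
  rfl

/-- Duhamel's formula exhibits the law through a primitive of a locally bounded function, hence as
continuous. With continuous rates the integrand is then continuous at positive times, and the same
formula becomes differentiable. -/
theorem continuousOn_toReal_mass (h : IsJumpChain ℙ χ T q) (y : E) :
    ContinuousOn (fun t => (mass ℙ χ T t y).toReal) (Set.Ici 0) := by
  have hc := intervalIntegral.continuous_primitive (h.intervalIntegrable_expInflux y) 0
  have hc' : Continuous fun t : ℝ => Real.exp (-t) * (ℙ.real {ξ | χ 0 ξ = y} +
      ∫ τ in (0)..t, expInflux ℙ χ T q y τ) := by fun_prop
  exact hc'.continuousOn.congr fun t ht => h.toReal_mass ht y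

/-- The forward equation. -/
theorem hasDerivAt_toReal_mass (h : IsJumpChain ℙ χ T q)
    (hq : ∀ x y, ∀ t, 0 < t → ContinuousAt (fun τ => (q τ x y).toReal) t) {t : ℝ} (ht : 0 < t)
    (y : E) : HasDerivAt (fun t => (mass ℙ χ T t y).toReal)
      (influx ℙ χ T q y t - (mass ℙ χ T t y).toReal) t := by
  have hnhds : Set.Ici (0 : ℝ) ∈ nhds t := Ici_mem_nhds ht
  have hcinf : ContinuousAt (influx ℙ χ T q y) t := by
    unfold influx
    refine tendsto_finsetSum _ fun x _ => ?_
    exact ((h.continuousOn_toReal_mass x).continuousAt hnhds).mul (hq x y t ht)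
  have hcexp : ContinuousAt (expInflux ℙ χ T q y) t := by
    refine (Real.continuous_exp.continuousAt.mul hcinf).congr ?_
    filter_upwards [hnhds] with τ hτ
    rw [expInflux, Set.indicator_of_mem hτ]
    rfl
  have hder := intervalIntegral.integral_hasDerivAt_right
    (h.intervalIntegrable_expInflux y 0 t)
    (h.measurable_expInflux y).stronglyMeasurable.stronglyMeasurableAtFilter hcexp
  have hexp : HasDerivAt (fun t : ℝ => Real.exp (-t)) (-Real.exp (-t)) t := by
    simpa using (hasDerivAt_neg t).exp
  have hall := hexp.mul (hder.const_add (ℙ.real {ξ | χ 0 ξ = y}))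
  have hcongr : (fun t => (mass ℙ χ T t y).toReal) =ᶠ[nhds t] fun t => Real.exp (-t) *
      (ℙ.real {ξ | χ 0 ξ = y} + ∫ τ in (0)..t, expInflux ℙ χ T q y τ) := by
    filter_upwards [hnhds] with τ hτ using h.toReal_mass hτ y
  refine (hall.congr_of_eventuallyEq hcongr).congr_deriv ?_
  rw [h.toReal_mass ht.le, expInflux, Set.indicator_of_mem (by exact ht.le), ← mul_assoc,
    ← Real.exp_add]
  simp
  ring

theorem sum_influx (h : IsJumpChain ℙ χ T q) {t : ℝ} (ht : 0 ≤ t) :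
    ∑ y, influx ℙ χ T q y t = ∑ x, (mass ℙ χ T t x).toReal := by
  unfold influx
  rw [Finset.sum_comm]
  refine Finset.sum_congr rfl fun x _ => ?_
  rw [← Finset.mul_sum, ← ENNReal.toReal_sum fun y _ =>
    ne_top_of_le_ne_top ENNReal.one_ne_top (h.rate_le_one ht x y), h.rate_sum t ht]
  simp

/-- The chain does not explode: the total mass is conserved. -/
theorem sum_toReal_mass (h : IsJumpChain ℙ χ T q)
    (hq : ∀ x y, ∀ t, 0 < t → ContinuousAt (fun τ => (q τ x y).toReal) t) {t : ℝ} (ht : 0 < t) :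
    ∑ x, (mass ℙ χ T t x).toReal = 1 := by
  -- Mean value theorem on `[0, t]`: total influx equals total mass, so the slope vanishes and the
  -- mass keeps its initial value `1`.
  obtain ⟨c, hc, hslope⟩ := exists_hasDerivAt_eq_slope (fun t => ∑ x, (mass ℙ χ T t x).toReal)
    (fun t => ∑ x, (influx ℙ χ T q x t - (mass ℙ χ T t x).toReal)) ht
    (continuousOn_finsetSum _ fun x _ => (h.continuousOn_toReal_mass x).mono
      fun t ht => ht.1)
    (fun t ht => HasDerivAt.fun_sum fun x _ => h.hasDerivAt_toReal_mass hq ht.1 x)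
  rw [Finset.sum_sub_distrib, h.sum_influx hc.1.le, sub_self, eq_comm,
    div_eq_zero_iff, sub_zero] at hslope
  have h0 : ∑ x, (mass ℙ χ T 0 x).toReal = 1 := by
    have e : ∀ x, (mass ℙ χ T 0 x).toReal = ℙ.real {ξ | χ 0 ξ = x} := fun x => by
      rw [h.toReal_mass le_rfl]; simp
    simp only [e, measureReal_def]
    rw [← ENNReal.toReal_sum fun x _ => measure_ne_top _ _]
    have := h.measure_eq_sum_state 0 Set.univ
    simp only [Set.mem_univ, true_and, measure_univ] at this
    rw [← this, ENNReal.toReal_one]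
  rcases hslope with h1 | h1
  · rw [← h0]; exact sub_eq_zero.1 h1
  · exact absurd h1 ht.ne'

/-- The law of the process that follows the chain. -/
theorem measureReal_notMem_le (h : IsJumpChain ℙ χ T q)
    (hq : ∀ x y, ∀ t, 0 < t → ContinuousAt (fun τ => (q τ x y).toReal) t) {X : ℝ → Ξ → E}
    (hX : ∀ᵐ ξ ∂ℙ, ∀ (k : ℕ) (t : ℝ), T k ξ ≤ t → t < T (k + 1) ξ → X t ξ = χ k ξ) {t : ℝ}
    (ht : 0 < t) (S : Finset E) :
    ℙ.real {ξ | X t ξ ∈ S} ≤ ∑ x ∈ S, (mass ℙ χ T t x).toReal := by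
  have hfin : ∀ x, mass ℙ χ T t x ≠ ⊤ := fun x =>
    ne_top_of_le_ne_top ENNReal.one_ne_top (h.mass_le_one ht.le x)
  have hT := h.measurable_time
  have hU : ∀ᵐ ξ ∂ℙ, ξ ∈ ⋃ k, {ξ | T k ξ ≤ t ∧ t < T (k + 1) ξ} := by
    have hm : MeasurableSet (⋃ k, {ξ | T k ξ ≤ t ∧ t < T (k + 1) ξ}) :=
      MeasurableSet.iUnion fun k => (measurableSet_le (hT k) measurable_const).inter
        (measurableSet_lt measurable_const (hT (k + 1)))
    refine (mem_ae_iff_prob_eq_one (μ := ℙ) hm).2 ?_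
    rw [← h.sum_mass ht.le, ← ENNReal.toReal_eq_one_iff, ENNReal.toReal_sum fun x _ => hfin x]
    exact h.sum_toReal_mass hq ht
  rw [measureReal_def, ← ENNReal.toReal_sum fun x _ => hfin x]
  refine ENNReal.toReal_mono (ENNReal.sum_ne_top.2 fun x _ => hfin x) ?_
  -- `X t` need not be measurable: the outer measure is bounded by covering with sojourn events, and
  -- this inequality is all that is needed.
  calc ℙ {ξ | X t ξ ∈ S}
      ≤ ℙ (⋃ x ∈ S, ⋃ k, {ξ | ξ ∈ {ξ | T k ξ ≤ t ∧ t < T (k + 1) ξ} ∧ χ k ξ = x}) := by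
        refine measure_mono_ae ?_
        filter_upwards [hX, hU] with ξ h1 h2 h3
        obtain ⟨k, hk⟩ := Set.mem_iUnion.1 h2
        refine Set.mem_biUnion (x := X t ξ) h3 (Set.mem_iUnion.2 ⟨k, hk, ?_⟩)
        exact (h1 k t hk.1 hk.2).symm
    _ ≤ ∑ x ∈ S, ℙ (⋃ k, {ξ | ξ ∈ {ξ | T k ξ ≤ t ∧ t < T (k + 1) ξ} ∧ χ k ξ = x}) :=
        measure_biUnion_finset_le _ _
    _ ≤ _ := by
        refine Finset.sum_le_sum fun x _ => (measure_iUnion_le _).trans (le_of_eq ?_)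
        exact tsum_congr fun k => (h.occupation_eq k ht.le x).symm

theorem toReal_mass_eq_zero (h : IsJumpChain ℙ χ T q) {A : Set E}
    (h0 : ∀ᵐ ξ ∂ℙ, χ 0 ξ ∈ A) (hA : ∀ τ, 0 ≤ τ → ∀ x ∈ A, ∀ y ∉ A, q τ x y = 0) (t : ℝ)
    {y : E} (hy : y ∉ A) : (mass ℙ χ T t y).toReal = 0 := by
  simp [mass, h.occupation_eq_zero h0 hA _ t hy]

end IsJumpChain

/-! ### The annealing process as a jump chain -/

/-- Integrating a version of a conditional probability over an event of the past. -/
theorem integrable_and_setIntegral_of_condExp_indicator {Ξ : Type*} {m m₀ : MeasurableSpace Ξ}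
    (hm : m ≤ m₀) {μ : Measure Ξ} [IsFiniteMeasure μ] {B S : Set Ξ} (hB : MeasurableSet B)
    (hS : MeasurableSet[m] S) {R : Ξ → ℝ} (h : μ[B.indicator fun _ => (1 : ℝ) | m] =ᵐ[μ] R) :
    Integrable R μ ∧ ∫ ξ in S, R ξ ∂μ = μ.real (B ∩ S) := by
  refine ⟨integrable_condExp.congr h, ?_⟩
  rw [← setIntegral_congr_ae (hm S hS) (h.mono fun ξ hξ _ => hξ),
    setIntegral_condExp hm ((integrable_const (1 : ℝ)).indicator hB) hS,
    integral_indicator_const _ hB, measureReal_restrict_apply hB, smul_eq_mul, mul_one]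

/-- The information carried by the chain up to step `k`. -/
abbrev chainPast {E Ξ : Type*} [MeasurableSpace E] (χ : ℕ → Ξ → E) (T : ℕ → Ξ → ℝ) (k : ℕ) :
    MeasurableSpace Ξ :=
  ⨆ i ∈ Set.Iic k, MeasurableSpace.comap (fun ξ => (χ i ξ, T i ξ)) inferInstance

theorem chainPast_le {E Ξ : Type*} [MeasurableSpace E] [m₀ : MeasurableSpace Ξ] {χ : ℕ → Ξ → E}
    {T : ℕ → Ξ → ℝ} (hχ : ∀ k, Measurable (χ k)) (hT : ∀ k, Measurable (T k)) (k : ℕ) :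
    chainPast χ T k ≤ m₀ :=
  iSup₂_le fun i _ => ((hχ i).prodMk (hT i)).comap_le

theorem measurableSet_chainPast {E Ξ : Type*} [MeasurableSpace E] [MeasurableSingletonClass E]
    (χ : ℕ → Ξ → E) (T : ℕ → Ξ → ℝ) (k : ℕ) (x : E) {A : Set ℝ} (hA : MeasurableSet A) :
    MeasurableSet[chainPast χ T k] {ξ | χ k ξ = x ∧ T k ξ ∈ A} := by
  have h1 : MeasurableSet[MeasurableSpace.comap (fun ξ => (χ k ξ, T k ξ)) inferInstance]
      {ξ | χ k ξ = x ∧ T k ξ ∈ A} :=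
    ⟨{x} ×ˢ A, (measurableSet_singleton x).prod hA, rfl⟩
  exact le_iSup₂ (f := fun i (_ : i ∈ Set.Iic k) =>
    MeasurableSpace.comap (fun ξ => (χ i ξ, T i ξ)) inferInstance) k (Set.mem_Iic.2 le_rfl) _ h1

namespace NoisyProblem

variable {E Ω : Type*} [Fintype E] [DecidableEq E] [MeasurableSpace Ω] (P : NoisyProblem E Ω)

/-- The rate of accepted moves. -/
noncomputable def moveRate (b d α t : ℝ) (x y : E) : ℝ :=
  P.q0 x y * P.acceptProb (b * Real.log (t * d + 1)) ((1 + t * d) ^ α).toNNReal x y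

/-- The diagonal value of `moveRate` enters with both signs and cancels, so the sum may run over all
states. -/
theorem qTime_eq (b d α t : ℝ) (x y : E) : P.qTime b d α t x y =
    P.moveRate b d α t x y + if y = x then 1 - ∑ z, P.moveRate b d α t x z else 0 := by
  rw [qTime, qNoisy]
  split_ifs with h
  · subst h
    have := Finset.add_sum_erase Finset.univ (fun z => P.moveRate b d α t y z) (Finset.mem_univ y)
    rw [← this]
    simp only [moveRate]
    ring
  · rw [add_zero, moveRate]

section

variable {b d α t : ℝ}

theorem beta_nonneg (hb : 0 < b) (hd : 0 < d) (ht : 0 ≤ t) : 0 ≤ b * Real.log (t * d + 1) :=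
  mul_nonneg hb.le (Real.log_nonneg (by have := mul_nonneg ht hd.le; linarith))

theorem moveRate_nonneg (x y : E) : 0 ≤ P.moveRate b d α t x y :=
  mul_nonneg (P.q0_nonneg x y) (P.acceptProb_nonneg _ _ x y)

theorem sum_qTime (x : E) : ∑ y, P.qTime b d α t x y = 1 := by
  simp only [qTime_eq, Finset.sum_add_distrib, Finset.sum_ite_eq', Finset.mem_univ, if_true]
  ring

theorem qTime_nonneg (hb : 0 < b) (hd : 0 < d) (ht : 0 ≤ t) (x y : E) :
    0 ≤ P.qTime b d α t x y := by
  rw [qTime_eq]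
  refine add_nonneg (P.moveRate_nonneg x y) ?_
  split_ifs
  · refine sub_nonneg.2 (le_trans (Finset.sum_le_sum fun z _ => ?_) (P.q0_sum x).le)
    exact mul_le_of_le_one_right (P.q0_nonneg x z)
      (P.acceptProb_le_one (beta_nonneg hb hd ht) _ x z)
  · exact le_rfl

theorem qTime_eq_zero {x y : E} (hx : x ∈ P.admissible) (hy : y ∉ P.admissible) :
    P.qTime b d α t x y = 0 := by
  rw [qTime_eq, moveRate, P.acceptProb_eq_zero hx hy, mul_zero, if_neg, add_zero]
  rintro rfl
  exact hy hx

theorem continuousOn_qTime (hb : 0 < b) (hd : 0 < d) (hα : 0 < α) (x y : E) :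
    ContinuousOn (fun t => P.qTime b d α t x y) (Set.Ici 0) := by
  have hacc : ∀ x y, ContinuousOn (fun t => P.moveRate b d α t x y) (Set.Ici 0) := by
    intro x y t₀ ht₀
    have hpos : ∀ t ∈ Set.Ico 0 (t₀ + 1), 0 < t * d + 1 := fun t ht => by
      have := mul_nonneg ht.1 hd.le; linarith
    -- The Poisson intensity is bounded only on bounded time intervals, so continuity is first
    -- proved on `[0, t₀ + 1)`.
    have hc : ContinuousOn (fun t => P.moveRate b d α t x y) (Set.Ico 0 (t₀ + 1)) := by
      refine continuousOn_const.mul (P.continuousOn_acceptProb ?_ ?_ ?_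
        (R := (1 + (t₀ + 1) * d) ^ α) ?_ x y)
      · refine continuousOn_const.mul (ContinuousOn.log (by fun_prop) fun t ht => (hpos t ht).ne')
      · exact fun t ht => beta_nonneg hb hd ht.1
      · refine continuous_real_toNNReal.comp_continuousOn ?_
        exact ContinuousOn.rpow_const (by fun_prop) fun t ht => Or.inr hα.le
      · intro t ht
        have := hpos t ht
        rw [Real.coe_toNNReal _ (Real.rpow_nonneg (by linarith) _)]
        have := ht.2.le
        gcongr
        linarith
    refine (hc t₀ ⟨ht₀, by linarith⟩).mono_of_mem_nhdsWithin ?_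
    rw [← Set.Ici_inter_Iio]
    exact inter_mem_nhdsWithin _ (Iio_mem_nhds (by linarith))
  simp only [qTime_eq]
  refine (hacc x y).add ?_
  split_ifs
  · exact continuousOn_const.sub (continuousOn_finsetSum _ fun z _ => hacc x z)
  · exact continuousOn_const

end

/-- The transition probabilities at nonnegative times, with values in `[0, ∞]`. -/
noncomputable def jumpRate (b d α : ℝ) (t : ℝ) (x y : E) : ℝ≥0∞ :=
  (Set.Ici 0).indicator (fun t => ENNReal.ofReal (P.qTime b d α t x y)) t

variable {P} {Ξ : Type*} [MeasurableSpace Ξ]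
  {b d α : ℝ} {ℙ : Measure Ξ} {χ : ℕ → Ξ → E} {T : ℕ → Ξ → ℝ} {X : ℝ → Ξ → E}

theorem jumpRate_of_nonneg {t : ℝ} (ht : 0 ≤ t) (x y : E) :
    P.jumpRate b d α t x y = ENNReal.ofReal (P.qTime b d α t x y) :=
  Set.indicator_of_mem (by exact ht) _

theorem measurable_jumpRate (hb : 0 < b) (hd : 0 < d) (hα : 0 < α) (x y : E) :
    Measurable fun t => P.jumpRate b d α t x y := by
  classical
  have h := ContinuousOn.measurable_piecewise (s := Set.Ici (0 : ℝ)) (g := fun _ => (0 : ℝ≥0∞))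
    (ENNReal.continuous_ofReal.comp_continuousOn (P.continuousOn_qTime hb hd hα x y))
    continuousOn_const measurableSet_Ici
  convert h using 1
  ext t
  simp [jumpRate, Set.indicator, Set.piecewise]

/-- The conditional transition law is integrated over the past event `{χ k = x, T k ∈ A}`; on it the
random state in the rate is the constant `x`. -/
theorem IsNSARun.isJumpChain [MeasurableSpace E] [MeasurableSingletonClass E] [IsProbabilityMeasure ℙ] (hX : P.IsNSARun b d α ℙ χ T X)
    (hb : 0 < b) (hd : 0 < d) (hα : 0 < α) : IsJumpChain ℙ χ T (P.jumpRate b d α) where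
  measurable_state := hX.measurable_state
  measurable_time := hX.measurable_time
  time_zero := hX.time_zero
  measurable_rate x y := measurable_jumpRate hb hd hα x y
  rate_sum τ hτ x := by
    simp only [jumpRate_of_nonneg hτ]
    rw [← ENNReal.ofReal_sum_of_nonneg fun y _ => P.qTime_nonneg hb hd hτ x y, P.sum_qTime,
      ENNReal.ofReal_one]
  step k x y A u hA hu := by
    have hχ := hX.measurable_state
    have hT := hX.measurable_time
    set S : Set Ξ := {ξ | χ k ξ = x ∧ T k ξ ∈ A} with hS
    set B : Set Ξ := {ξ | χ (k + 1) ξ = y ∧ u ≤ T (k + 1) ξ} with hB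
    have hle := chainPast_le hχ hT k
    have hSm := measurableSet_chainPast χ T k x hA
    have hSm' : MeasurableSet S := hle S hSm
    have hBm : MeasurableSet B :=
      (hχ (k + 1) (measurableSet_singleton y)).inter (hT (k + 1) measurableSet_Ici)
    set R : Ξ → ℝ := fun ξ => ∫ τ in Set.Ici u, (Set.Ici (T k ξ)).indicator
        (fun τ => P.qTime b d α τ (χ k ξ) y * Real.exp (-(τ - T k ξ))) τ with hR
    have htr : ℙ[B.indicator fun _ => (1 : ℝ) | chainPast χ T k] =ᵐ[ℙ] R := hX.transition k y u hu
    have hRnn : ∀ ξ, ∀ τ ∈ Set.Ici u, 0 ≤ (Set.Ici (T k ξ)).indicator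
        (fun τ => P.qTime b d α τ (χ k ξ) y * Real.exp (-(τ - T k ξ))) τ := fun ξ τ hτ =>
      Set.indicator_apply_nonneg fun _ => mul_nonneg
        (P.qTime_nonneg hb hd (hu.trans hτ) _ _) (Real.exp_nonneg _)
    obtain ⟨hRi, hset⟩ := integrable_and_setIntegral_of_condExp_indicator hle hBm hSm htr
    have hRof : ∀ ξ ∈ S, ENNReal.ofReal (R ξ) =
        ∫⁻ τ in Set.Ici u, P.jumpRate b d α τ x y * waitDensity (T k ξ) τ := by
      intro ξ hξ
      have e : ∀ τ ∈ Set.Ici u, ENNReal.ofReal ((Set.Ici (T k ξ)).indicator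
          (fun τ => P.qTime b d α τ (χ k ξ) y * Real.exp (-(τ - T k ξ))) τ) =
          P.jumpRate b d α τ x y * waitDensity (T k ξ) τ := by
        intro τ hτ
        have hτ0 : 0 ≤ τ := hu.trans hτ
        rw [jumpRate_of_nonneg hτ0, waitDensity]
        by_cases h : T k ξ ≤ τ
        · rw [Set.indicator_of_mem (by exact h), if_pos h, hξ.1,
            ENNReal.ofReal_mul (P.qTime_nonneg hb hd hτ0 _ _)]
        · rw [Set.indicator_of_notMem (by exact h), if_neg h, ENNReal.ofReal_zero, mul_zero]
      have hfin : ∫⁻ τ in Set.Ici u, P.jumpRate b d α τ x y * waitDensity (T k ξ) τ ≠ ⊤ := by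
        refine ne_top_of_le_ne_top (b := ∫⁻ τ in Set.Ici u, waitDensity (T k ξ) τ) ?_
          (setLIntegral_mono' measurableSet_Ici fun τ hτ => ?_)
        · rw [lintegral_waitDensity]; exact ENNReal.ofReal_ne_top
        · refine mul_le_of_le_one_left zero_le ?_
          have hτ0 : 0 ≤ τ := hu.trans hτ
          rw [jumpRate_of_nonneg hτ0, ENNReal.ofReal_le_one, ← P.sum_qTime (b := b) (d := d)
            (α := α) (t := τ) x]
          exact Finset.single_le_sum (f := fun y => P.qTime b d α τ x y)
            (fun z _ => P.qTime_nonneg hb hd hτ0 x z) (Finset.mem_univ y)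
      have haesm : AEStronglyMeasurable (fun τ => (Set.Ici (T k ξ)).indicator
          (fun τ => P.qTime b d α τ (χ k ξ) y * Real.exp (-(τ - T k ξ))) τ)
          (volume.restrict (Set.Ici u)) := by
        refine AEStronglyMeasurable.indicator ?_ measurableSet_Ici
        refine ContinuousOn.aestronglyMeasurable ?_ measurableSet_Ici
        exact ((P.continuousOn_qTime hb hd hα _ _).mono (Set.Ici_subset_Ici.2 hu)).mul
          (by fun_prop)
      rw [hR]
      simp only
      rw [integral_eq_lintegral_of_nonneg_ae
        ((ae_restrict_iff' measurableSet_Ici).2 (ae_of_all _ (hRnn ξ))) haesm,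
        setLIntegral_congr_fun measurableSet_Ici e, ENNReal.ofReal_toReal hfin]
    calc ℙ {ξ | (χ k ξ = x ∧ T k ξ ∈ A) ∧ χ (k + 1) ξ = y ∧ u ≤ T (k + 1) ξ}
        = ℙ (B ∩ S) := by rw [Set.inter_comm]; rfl
      _ = ENNReal.ofReal (∫ ξ in S, R ξ ∂ℙ) := by
          rw [hset, measureReal_def, ENNReal.ofReal_toReal (measure_ne_top _ _)]
      _ = ∫⁻ ξ in S, ENNReal.ofReal (R ξ) ∂ℙ :=
          ofReal_integral_eq_lintegral_ofReal hRi.integrableOn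
            (ae_of_all _ fun ξ => setIntegral_nonneg measurableSet_Ici (hRnn ξ))
      _ = _ := setLIntegral_congr_fun hSm' hRof

end NoisyProblem

/-! ### The landscape of admissible states and the conclusion -/

/-- A sum over a type of a function vanishing off a set. -/
theorem sum_subtype_of_eq_zero {E : Type*} [Fintype E] {A : Set E} [Fintype A]
    (f : E → ℝ) (hf : ∀ x ∉ A, f x = 0) : ∑ x : A, f x = ∑ x, f x := by
  classical
  rw [← Finset.sum_subset (Finset.subset_univ A.toFinset)
    (fun x _ hx => hf x (by simpa using hx))]
  exact (Finset.sum_subtype A.toFinset (by simp) f).symm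

namespace NoisyProblem

variable {E Ω : Type*} [Fintype E] [DecidableEq E] [MeasurableSpace Ω] (P : NoisyProblem E Ω)

/-- The elevation is attained by some path. -/
theorem exists_isPath_iSup_le (x y : E) (h : P.elevation x y ≠ ⊤) :
    ∃ (n : ℕ) (p : Fin (n + 1) → E), P.IsPath x y n p ∧ ∀ i, P.J (p i) ≤ P.elevation x y := by
  by_contra! hne
  -- `sInf (insert ⊤ S)` is the next value of `J` above the elevation. If every path exceeded the
  -- elevation, each would reach this value, and so would the infimum over paths.
  set S : Set ℝ≥0∞ := {v | v ∈ Set.range P.J ∧ P.elevation x y < v} with hS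
  have hfin : (insert ⊤ S).Finite := ((Set.finite_range P.J).subset fun v hv => hv.1).insert ⊤
  have hmem := Set.Nonempty.csInf_mem (Set.insert_nonempty ⊤ S) hfin
  have hlt : P.elevation x y < sInf (insert ⊤ S) := by
    rcases hmem with h1 | h1
    · rw [h1]; exact h.lt_top
    · exact h1.2
  refine absurd hlt (not_lt.2 ?_)
  refine le_iInf fun n => le_iInf fun p => le_iInf fun hp => ?_
  obtain ⟨i, hi⟩ := hne n p hp
  exact (sInf_le (Set.mem_insert_of_mem ⊤ (show P.J (p i) ∈ S from ⟨⟨p i, rfl⟩, hi⟩))).trans (le_iSup (fun i => P.J (p i)) i)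

theorem mem_admissible_of_J_ne_top {x : E} (h : P.J x ≠ ⊤) : x ∈ P.admissible := by
  by_contra hx
  exact h (P.J_eq_top hx)

theorem elevation_le (x y : E) : P.elevation x y ≤ P.mStar + max (P.J x) (P.J y) := by
  rw [← tsub_le_iff_right]
  exact le_iSup₂ (f := fun x y => P.elevation x y - max (P.J x) (P.J y)) x y

theorem exists_minimizer (h : P.admissible.Nonempty) :
    ∃ x₀ ∈ P.admissible, ∀ y, P.J x₀ ≤ P.J y := by
  obtain ⟨z, hz⟩ := h
  obtain ⟨x₀, -, hx₀⟩ := Finset.exists_min_image Finset.univ P.J ⟨z, Finset.mem_univ z⟩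
  exact ⟨x₀, P.mem_admissible_of_J_ne_top (ne_top_of_le_ne_top (P.J_ne_top hz)
    (hx₀ z (Finset.mem_univ z))), fun y => hx₀ y (Finset.mem_univ y)⟩

/-- The energy landscape of the admissible states. -/
noncomputable def landscape [Fintype P.admissible] {b : ℝ} (hb : 0 < b) {x₀ : E} (hx₀ : x₀ ∈ P.admissible)
    (hmin : ∀ y, P.J x₀ ≤ P.J y) : EnergyLandscape P.admissible where
  mu x := P.mu0 x
  mu_pos x := P.mu0_pos x x.2
  mu_sum := by
    rw [← P.mu0_sum, ← Finset.sum_subtype P.admissible.toFinset (by simp)]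
    exact Finset.sum_le_univ_sum_of_nonneg P.mu0_nonneg
  q x y := P.q0 x y
  q_nonneg x y := P.q0_nonneg x y
  q_sum x := by
    rw [← P.q0_sum x, ← Finset.sum_subtype P.admissible.toFinset (by simp)]
    exact Finset.sum_le_univ_sum_of_nonneg (P.q0_nonneg x)
  reversible x y := P.q0_reversible x y
  θ x := b * ((P.J x).toReal - (P.J x₀).toReal)
  θ_nonneg x := mul_nonneg hb.le (sub_nonneg.2 (ENNReal.toReal_mono (P.J_ne_top x.2) (hmin x)))
  ground := ⟨x₀, hx₀⟩
  θ_ground := by simp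

/-- A path of finite elevation stays among admissible states; subtracting `J⋆` and multiplying by
`b` turns its costs into exponents. -/
theorem landscape_depthLE [Fintype P.admissible] {b : ℝ} (hb : 0 < b) {x₀ : E} (hx₀ : x₀ ∈ P.admissible)
    (hmin : ∀ y, P.J x₀ ≤ P.J y) (hm : P.mStar ≠ ⊤) :
    (P.landscape hb hx₀ hmin).DepthLE (P.mStar.toReal * b) := by
  rintro ⟨x, hx⟩ ⟨y, hy⟩
  have hle := P.elevation_le x y
  have hmax : max (P.J x) (P.J y) ≠ ⊤ := (max_lt (P.J_ne_top hx).lt_top (P.J_ne_top hy).lt_top).ne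
  have hrhs : P.mStar + max (P.J x) (P.J y) ≠ ⊤ := ENNReal.add_ne_top.2 ⟨hm, hmax⟩
  have helev : P.elevation x y ≠ ⊤ := ne_top_of_le_ne_top hrhs hle
  obtain ⟨n, p, ⟨hp0, hpn, hpath⟩, hpJ⟩ := P.exists_isPath_iSup_le x y helev
  have hadm : ∀ i, p i ∈ P.admissible := fun i =>
    P.mem_admissible_of_J_ne_top (ne_top_of_le_ne_top helev (hpJ i))
  set H := b * ((P.elevation x y).toReal - (P.J x₀).toReal) with hH
  refine ⟨H, ?_, ?_⟩
  · have h1 : (P.elevation x y).toReal ≤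
        P.mStar.toReal + max (P.J x).toReal (P.J y).toReal := by
      have := ENNReal.toReal_mono hrhs hle
      rwa [ENNReal.toReal_add hm hmax, ENNReal.toReal_max (P.J_ne_top hx) (P.J_ne_top hy)] at this
    change H ≤ P.mStar.toReal * b + max (b * ((P.J x).toReal - (P.J x₀).toReal))
      (b * ((P.J y).toReal - (P.J x₀).toReal))
    rw [← mul_max_of_nonneg _ _ hb.le, max_sub_sub_right, hH]
    have := mul_le_mul_of_nonneg_left h1 hb.le
    linarith
  · have hθ : ∀ i, (P.landscape hb hx₀ hmin).θ ⟨p i, hadm i⟩ ≤ H := fun i =>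
      mul_le_mul_of_nonneg_left (sub_le_sub_right (ENNReal.toReal_mono helev (hpJ i)) _) hb.le
    have key : ∀ i : Fin (n + 1), Relation.ReflTransGen
        ((P.landscape hb hx₀ hmin).StepBelow H) ⟨x, hx⟩ ⟨p i, hadm i⟩ := by
      intro i
      induction i using Fin.induction with
      | zero =>
        have : (⟨p 0, hadm 0⟩ : P.admissible) = ⟨x, hx⟩ := Subtype.ext hp0
        rw [this]
      | succ i ih =>
        -- A path may stay in place, and `q0` need not charge the diagonal: such steps are skipped.
        by_cases heq : p i.succ = p i.castSucc
        · have : (⟨p i.succ, hadm i.succ⟩ : P.admissible) = ⟨p i.castSucc, hadm i.castSucc⟩ :=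
            Subtype.ext heq
          rw [this]
          exact ih
        · exact ih.tail ⟨P.q0_pos _ _ (hpath i) heq, hθ _, hθ _⟩
    have := key (Fin.last n)
    have e : (⟨p (Fin.last n), hadm (Fin.last n)⟩ : P.admissible) = ⟨y, hy⟩ := Subtype.ext hpn
    rwa [e] at this

theorem landscape_rate [Fintype P.admissible] {b : ℝ} (hb : 0 < b) {x₀ : E} (hx₀ : x₀ ∈ P.admissible)
    (hmin : ∀ y, P.J x₀ ≤ P.J y) {s : ℝ} (hs : 0 < s) (x y : P.admissible) :
    (P.landscape hb hx₀ hmin).rate s x y =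
      P.q0 x y * Real.exp (-(b * Real.log s * max 0 ((P.J y).toReal - (P.J x).toReal))) := by
  change P.q0 x y * s ^ (-max 0 (b * ((P.J y).toReal - (P.J x₀).toReal) -
    b * ((P.J x).toReal - (P.J x₀).toReal))) = _
  rw [Real.rpow_def_of_pos hs]
  have : max 0 (b * ((P.J y).toReal - (P.J x₀).toReal) - b * ((P.J x).toReal - (P.J x₀).toReal)) =
      b * max 0 ((P.J y).toReal - (P.J x).toReal) := by
    rw [mul_max_of_nonneg _ _ hb.le]; congr 1 <;> ring
  rw [this]
  congr 2
  ring

/-- The proposition probability is a common factor, so the relative error of the acceptance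
probability carries over; `κ ≤ α / 2` weakens `s ^ (-α/4)` to `s ^ (-κ/2)`. -/
theorem exists_abs_moveRate_sub_le [Fintype P.admissible] {b d α κ : ℝ} (hb : 0 < b) (hd : 0 < d) (hα : 0 < α)
    (hκ : κ ≤ α / 2) {x₀ : E} (hx₀ : x₀ ∈ P.admissible) (hmin : ∀ y, P.J x₀ ≤ P.J y) :
    ∃ C : ℝ, ∀ t, 0 < t → ∀ x y : P.admissible,
      |P.moveRate b d α t x y - (P.landscape hb hx₀ hmin).rate (1 + t * d) x y| ≤
        C * (1 + t * d) ^ (-(κ / 2)) * (P.landscape hb hx₀ hmin).rate (1 + t * d) x y := by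
  obtain ⟨C, hC, h⟩ := P.exists_abs_acceptProb_sub_le hb hα
  refine ⟨C, fun t ht x y => ?_⟩
  have hs : 1 ≤ 1 + t * d := by have := mul_pos ht hd; linarith
  rw [P.landscape_rate hb hx₀ hmin (s := 1 + t * d) (by linarith), moveRate, add_comm (t * d) 1, ← mul_sub, abs_mul,
    abs_of_nonneg (P.q0_nonneg _ _), mul_left_comm]
  refine mul_le_mul_of_nonneg_left ((h x x.2 y y.2 _ hs).trans ?_) (P.q0_nonneg _ _)
  gcongr 2
  exact Real.rpow_le_rpow_of_exponent_le hs (by linarith)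

theorem continuousAt_toReal_jumpRate {b d α : ℝ} (hb : 0 < b) (hd : 0 < d) (hα : 0 < α) (x y : E) {t : ℝ}
    (ht : 0 < t) : ContinuousAt (fun τ => (P.jumpRate b d α τ x y).toReal) t := by
  have hn : Set.Ici (0 : ℝ) ∈ nhds t := Ici_mem_nhds ht
  refine ((P.continuousOn_qTime hb hd hα x y).continuousAt hn).congr ?_
  filter_upwards [hn] with τ hτ
  rw [jumpRate_of_nonneg hτ, ENNReal.toReal_ofReal (P.qTime_nonneg hb hd hτ x y)]

variable {P} {Ξ : Type*} [MeasurableSpace E] [MeasurableSingletonClass E] [MeasurableSpace Ξ]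
  {b d α : ℝ} {ℙ : Measure Ξ} [IsProbabilityMeasure ℙ] {χ : ℕ → Ξ → E} {T : ℕ → Ξ → ℝ}
  {X : ℝ → Ξ → E}

theorem IsNSARun.mass_eq_zero (hX : P.IsNSARun b d α ℙ χ T X) (hb : 0 < b) (hd : 0 < d)
    (hα : 0 < α) (t : ℝ) {y : E} (hy : y ∉ P.admissible) :
    (IsJumpChain.mass ℙ χ T t y).toReal = 0 :=
  (hX.isJumpChain hb hd hα).toReal_mass_eq_zero hX.init_admissible (fun τ hτ x hx y hy => by
    rw [jumpRate_of_nonneg hτ, P.qTime_eq_zero hx hy, ENNReal.ofReal_zero]) t hy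

/-- The master equation on the admissible states. -/
theorem IsNSARun.hasDerivAt_mass [Fintype P.admissible] (hX : P.IsNSARun b d α ℙ χ T X)
    (hb : 0 < b) (hd : 0 < d) (hα : 0 < α) {t : ℝ} (ht : 0 < t) (y : P.admissible) :
    HasDerivAt (fun t => (IsJumpChain.mass ℙ χ T t y).toReal)
      (∑ x : P.admissible, ((IsJumpChain.mass ℙ χ T t x).toReal * P.moveRate b d α t x y -
        (IsJumpChain.mass ℙ χ T t y).toReal * P.moveRate b d α t y x)) t := by
  have h := hX.isJumpChain hb hd hα
  refine (h.hasDerivAt_toReal_mass (fun x y t ht =>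
    P.continuousAt_toReal_jumpRate hb hd hα x y ht) ht y).congr_deriv ?_
  rw [IsJumpChain.influx, sum_subtype_of_eq_zero (A := P.admissible)
    (fun x => (IsJumpChain.mass ℙ χ T t x).toReal * P.moveRate b d α t x y -
        (IsJumpChain.mass ℙ χ T t y).toReal * P.moveRate b d α t y x)]
  -- The holding term on the diagonal, minus departures at unit rate, is exactly the outflow by
  -- accepted moves.
  · have e : ∀ x, (IsJumpChain.mass ℙ χ T t x).toReal * (P.jumpRate b d α t x y).toReal =
        (IsJumpChain.mass ℙ χ T t x).toReal * P.moveRate b d α t x y +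
        if (y : E) = x then (IsJumpChain.mass ℙ χ T t y).toReal *
          (1 - ∑ z, P.moveRate b d α t y z) else 0 := by
      intro x
      rw [jumpRate_of_nonneg ht.le, ENNReal.toReal_ofReal (P.qTime_nonneg hb hd ht.le x y),
        qTime_eq, mul_add]
      congr 1
      split_ifs with hxy
      · rw [← hxy]
      · rw [mul_zero]
    simp only [e, Finset.sum_add_distrib, Finset.sum_ite_eq, Finset.mem_univ, if_true,
      Finset.sum_sub_distrib, ← Finset.mul_sum]
    ring
  -- Outside `E'` both flows vanish: there is no mass to come in, and no move there is accepted.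
  · intro x hx
    rw [hX.mass_eq_zero hb hd hα t hx, moveRate, moveRate, P.acceptProb_eq_zero y.2 hx]
    ring

theorem IsNSARun.exists_measure_notMem_nearOptimal_le (hX : P.IsNSARun b d α ℙ χ T X)
    (hb : 0 < b) (hd : 0 < d) {κ : ℝ} (hα : 0 < α) (hκ : κ ≤ 1) (hκα : κ ≤ α / 2)
    (hm : P.mStar ≠ ⊤) (hmκ : P.mStar.toReal * b < κ) :
    ∃ B Γ : ℝ, 0 < B ∧ 1 ≤ Γ ∧ ∀ᶠ t : ℝ in atTop, ∀ ε : ℝ, 0 < ε →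
      ℙ.real {ξ | X t ξ ∉ P.nearOptimal ε} ≤
        B * (1 + t * d) ^ ((P.mStar.toReal * b - κ - b * ε) / 2) +
          Γ * (1 + t * d) ^ (-(b * ε)) := by
  classical
  have hne : P.admissible.Nonempty := by
    obtain ⟨ξ, hξ⟩ := hX.init_admissible.exists
    exact ⟨_, hξ⟩
  obtain ⟨x₀, hx₀, hmin⟩ := P.exists_minimizer hne
  set L := P.landscape hb hx₀ hmin with hL
  obtain ⟨C, hC⟩ := P.exists_abs_moveRate_sub_le hb hd hα hκα hx₀ hmin
  have h := hX.isJumpChain hb hd hα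
  have hcont : ∀ x y, ∀ t, 0 < t →
      ContinuousAt (fun τ => (P.jumpRate b d α τ x y).toReal) t := fun x y t ht =>
    P.continuousAt_toReal_jumpRate hb hd hα x y ht
  set m : ℝ → P.admissible → ℝ := fun t x => (IsJumpChain.mass ℙ χ T t x).toReal with hmdef
  have hsum : ∀ t, 0 < t → ∑ x, m t x = 1 := fun t ht => by
    rw [← h.sum_toReal_mass hcont ht]
    exact sum_subtype_of_eq_zero (fun x => (IsJumpChain.mass ℙ χ T t x).toReal)
      (fun x hx => hX.mass_eq_zero hb hd hα t hx)
  obtain ⟨B, hB0, hB⟩ := L.exists_energy_sub_le (P.landscape_depthLE hb hx₀ hmin hm) hmκ hκ hd hsum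
    (c := fun t x y => P.moveRate b d α t x y)
    (fun t ht y => hX.hasDerivAt_mass hb hd hα ht y) hC
  -- The square root of the chi-square constant, and the bound `1 / μ₀(x₀) ≥ 1` for `1 / Z`; neither
  -- these nor the threshold on `t` depends on `ε`.
  refine ⟨Real.sqrt B, 1 / L.mu L.ground, Real.sqrt_pos.2 hB0,
    (one_le_div (L.mu_pos _)).2 (L.mu_le_one _), ?_⟩
  filter_upwards [hB, eventually_gt_atTop 0] with t htB ht ε hε
  have hs : 1 ≤ 1 + t * d := by have := mul_pos ht hd; linarith
  have hs0 : 0 < 1 + t * d := by linarith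
  set S : Finset E := Finset.univ.filter fun x => x ∉ P.nearOptimal ε with hS
  have h1 := h.measureReal_notMem_le hcont hX.jump ht S
  have e1 : {ξ | X t ξ ∈ S} = {ξ | X t ξ ∉ P.nearOptimal ε} := by ext ξ; simp [hS]
  rw [e1] at h1
  set S' : Finset P.admissible := Finset.univ.filter fun x => (x : E) ∉ P.nearOptimal ε with hS'
  have e2 : ∑ x ∈ S, (IsJumpChain.mass ℙ χ T t x).toReal = ∑ x ∈ S', m t x := by
    rw [hS, hS', Finset.sum_filter, Finset.sum_filter]
    exact (sum_subtype_of_eq_zero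
      (fun x => if x ∉ P.nearOptimal ε then (IsJumpChain.mass ℙ χ T t x).toReal else 0)
      (fun x hx => by simp only [hX.mass_eq_zero hb hd hα t hx, ite_self])).symm
  rw [e2] at h1
  have hinf : ⨅ y, P.J y = P.J x₀ := le_antisymm (iInf_le _ _) (le_iInf hmin)
  have hθ : ∀ x ∈ S', b * ε ≤ L.θ x := by
    intro x hx
    have hx1 : ¬ P.J x ≤ P.J x₀ + ENNReal.ofReal ε := by
      have := (Finset.mem_filter.1 hx).2
      rwa [nearOptimal, Set.mem_ofPred_eq, hinf] at this
    have hx2 := ENNReal.toReal_mono (P.J_ne_top x.2) (not_le.1 hx1).le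
    rw [ENNReal.toReal_add (P.J_ne_top hx₀) ENNReal.ofReal_ne_top,
      ENNReal.toReal_ofReal hε.le] at hx2
    exact mul_le_mul_of_nonneg_left (by linarith) hb.le
  refine h1.trans ((L.sum_filter_le hs (hsum t ht) (b * ε) S' hθ).trans (add_le_add_left ?_ _))
  have e3 : (1 + t * d) ^ ((P.mStar.toReal * b - κ - b * ε) / 2) =
      Real.sqrt ((1 + t * d) ^ (P.mStar.toReal * b - κ)) * (1 + t * d) ^ (-(b * ε) / 2) := by
    rw [Real.sqrt_eq_rpow, ← Real.rpow_mul hs0.le, ← Real.rpow_add hs0]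
    congr 1
    ring
  rw [e3, ← mul_assoc, ← Real.sqrt_mul hB0.le]
  gcongr

end NoisyProblem

theorem mainTheorem2 {E Ω Ξ : Type*} [Fintype E] [DecidableEq E] [MeasurableSpace E]
    [MeasurableSingletonClass E] [MeasurableSpace Ω] [MeasurableSpace Ξ]
    (P : NoisyProblem E Ω) (b d α : ℝ) (hb : 0 < b) (hd : 0 < d)
    (hm : P.mStar * ENNReal.ofReal b < ENNReal.ofReal (min (α / 2) 1))
    (ℙ : Measure Ξ) [IsProbabilityMeasure ℙ]
    (χ : ℕ → Ξ → E) (T : ℕ → Ξ → ℝ) (X : ℝ → Ξ → E)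
    (hX : P.IsNSARun b d α ℙ χ T X) :
    ∃ Γ₂ : ℝ, 0 < Γ₂ ∧ ∀ γ ∈ Set.Ioo 0 (α / 2 - P.mStar.toReal * b),
      ∃ Γ : ℝ, 0 < Γ ∧ ∀ᶠ t : ℝ in atTop, ∀ ε : ℝ, 0 < ε →
        (2 ≤ α →
          ℙ.real {ξ | X t ξ ∉ P.nearOptimal ε} ≤
            Γ * Γ₂ * (1 + t * d) ^ ((P.mStar.toReal * b - 1 - b * ε) / 2)
              + Γ₂ * (1 + t * d) ^ (-(b * ε))) ∧
        (α < 2 →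
          ℙ.real {ξ | X t ξ ∉ P.nearOptimal ε} ≤
            Γ * Γ₂ * (1 + t * d) ^ ((P.mStar.toReal * b - α / 2 + γ - b * ε) / 2)
              + Γ₂ * (1 + t * d) ^ (-(b * ε))) := by
  have hmin : 0 < min (α / 2) 1 := ENNReal.ofReal_pos.1 (zero_le.trans_lt hm)
  have hα : 0 < α := by have := lt_min_iff.1 hmin; linarith
  have hmtop : P.mStar ≠ ⊤ := by
    intro htop
    rw [htop, ENNReal.top_mul (ENNReal.ofReal_pos.2 hb).ne'] at hm
    exact not_top_lt hm
  have hmb : P.mStar.toReal * b < min (α / 2) 1 := by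
    have := ENNReal.toReal_strict_mono ENNReal.ofReal_ne_top hm
    rwa [ENNReal.toReal_mul, ENNReal.toReal_ofReal hb.le, ENNReal.toReal_ofReal hmin.le] at this
  -- Taken with `κ = min (α/2) 1`, the slower of the decay of the squared noise error and that of
  -- the cooling.
  obtain ⟨B, Γ₂, hB, hΓ₂, hbound⟩ := hX.exists_measure_notMem_nearOptimal_le hb hd hα
    (min_le_right _ _) (min_le_left _ _) hmtop hmb
  -- The same `B` serves for every `γ`: positivity of `γ` only weakens the exponent, and `Γ₂ ≥ 1`
  -- passes from `B` to `B Γ₂`.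
  refine ⟨Γ₂, by linarith, fun γ hγ => ⟨B, hB, ?_⟩⟩
  filter_upwards [hbound, eventually_gt_atTop 0] with t ht ht0 ε hε
  have hs : 1 ≤ 1 + t * d := by have := mul_pos ht0 hd; linarith
  have hBΓ : B ≤ B * Γ₂ := le_mul_of_one_le_right hB.le hΓ₂
  refine ⟨fun h2 => (ht ε hε).trans ?_, fun h2 => (ht ε hε).trans ?_⟩
  · rw [min_eq_right (by linarith)]
    gcongr
  · rw [min_eq_left (by linarith)]
    refine add_le_add_left (mul_le_mul hBΓ (Real.rpow_le_rpow_of_exponent_le hs ?_)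
      (by positivity) (by positivity)) _
    linarith [hγ.1]
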